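/- Let $\Delta=\{\zeta\in\mathbb{C}:|\zeta|<1\}$ and let $u(z,w)=-\sqrt{\log|z|\,\log|w|}$ on the punctured bidisc $\Omega=\Delta^2\setminus\{(0,0)\}$, where $u=-\infty$ on the coordinate axes $\{zw=0\}$. For $m\in\mathbb{N}$ let $\chi_m:(-\infty,0)\to(-\infty,0)$ be bounded convex non-decreasing functions such that, for every $t<0$, the sequence $\chi_m(t)$ is non-increasing in $m$ and converges to $t$. Put $u_m=\chi_m(u)$, with $\chi_m(-\infty):=\lim_{t\to-\infty}\chi_m(t)$. Then for every $m$ the current $dd^c u_m$ is positive on $\Omega$, with measure coefficients, so that the Bedford–Taylor Monge–Ampère current $(dd^c u_m)^2=dd^c(u_m\,dd^c u_m)$ is defined on $\Omega$ (with $d^c=i(\bar\partial-\partial)$); and the sequence $(dd^c u_m)^2$ does not converge weakly to $0$ on $\Omega$ as $m\to\infty$, that is, there is $\varphi\in C_c^\infty(\Omega)$ such that $\int_\Omega u_m\,dd^c\varphi\wedge dd^c u_m$ does not tend to $0$. -/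

import Mathlib

open MeasureTheory Filter Topology TopologicalSpace
open scoped Distributions

noncomputable section

/-- The Levi form `∑ a_j (conj a_k) ∂²φ/∂z_j∂z̄_k (p)` of a real function `φ` on `ℂ²`, in the
direction `a = (a_1, a_2)`. It is a quarter of the Laplacian at `ζ = 0` of the function
`ζ ↦ φ (p + ζ a)` of one complex variable. -/
def leviForm (φ : ℂ × ℂ → ℝ) (a p : ℂ × ℂ) : ℝ :=
  (fderiv ℝ (fderiv ℝ φ) p a a
    + fderiv ℝ (fderiv ℝ φ) p (Complex.I • a) (Complex.I • a)) / 4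

/-- Polarization. If `Q a = ∑ a_j (conj a_k) h_{jk}` for a Hermitian matrix `h`, then the next four
quantities are `h_{11}`, `h_{22}`, `Re h_{12}` and `Im h_{12}`. -/
def coeff11 (Q : ℂ × ℂ → ℝ) : ℝ := Q (1, 0)

/-- The coefficient `h_{22}`. -/
def coeff22 (Q : ℂ × ℂ → ℝ) : ℝ := Q (0, 1)

/-- The real part of the coefficient `h_{12}`. -/
def coeffRe12 (Q : ℂ × ℂ → ℝ) : ℝ := (Q (1, 1) - Q (1, 0) - Q (0, 1)) / 2

/-- The imaginary part of the coefficient `h_{12}`. -/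
def coeffIm12 (Q : ℂ × ℂ → ℝ) : ℝ := (Q (1, Complex.I) - Q (1, 0) - Q (0, 1)) / 2

/-- `μ` is the (positive, Radon) measure on `Ω` that represents the distribution
`∑ a_j (conj a_k) ∂²v/∂z_j∂z̄_k`. For a plurisubharmonic `v` there is exactly one for each `a`.
A measure on `Ω` is regarded as a measure on `ℂ²` that does not charge the complement of `Ω`. -/
structure IsLeviMeasure (Ω : Opens (ℂ × ℂ)) (v : ℂ × ℂ → ℝ) (a : ℂ × ℂ)
    (μ : Measure (ℂ × ℂ)) : Prop where
  measure_compl : μ (Ω : Set (ℂ × ℂ))ᶜ = 0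
  lt_top_of_isCompact : ∀ K : Set (ℂ × ℂ), K ⊆ Ω → IsCompact K → μ K < ⊤
  integral_eq : ∀ φ : 𝓓(Ω, ℝ),
    ∫ p, φ p ∂μ = ∫ p in (Ω : Set (ℂ × ℂ)), v p * leviForm φ a p

/-- The current `dd^c v` is a positive current on `Ω`, with measure coefficients. -/
def HasLeviMeasures (Ω : Opens (ℂ × ℂ)) (v : ℂ × ℂ → ℝ) : Prop :=
  ∀ a : ℂ × ℂ, ∃ μ : Measure (ℂ × ℂ), IsLeviMeasure Ω v a μ

open Classical in
/-- The measure `∑ a_j (conj a_k) ∂²v/∂z_j∂z̄_k` on `Ω` (the zero measure if there is none). -/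
def leviMeasure (Ω : Opens (ℂ × ℂ)) (v : ℂ × ℂ → ℝ) (a : ℂ × ℂ) : Measure (ℂ × ℂ) :=
  if h : ∃ μ : Measure (ℂ × ℂ), IsLeviMeasure Ω v a μ then h.choose else 0

/-- The Monge-Ampère current `(dd^c v)² = dd^c (v dd^c v)` of Bedford and Taylor, for a locally
bounded plurisubharmonic function `v` on `Ω`, as a functional on the test functions:
`⟨(dd^c v)², φ⟩ = ∫ v dd^c φ ∧ dd^c v`. With `d^c = i (∂̄ - ∂)`, that is `dd^c = 2 i ∂∂̄`,
`dd^c φ ∧ dd^c v = 16 (φ_{22} v_{11} + φ_{11} v_{22} - 2 Re (conj φ_{12} v_{12})) dV`,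
where the `v_{jk}` are measures. -/
def mongeAmpere (Ω : Opens (ℂ × ℂ)) (v : ℂ × ℂ → ℝ) (φ : 𝓓(Ω, ℝ)) : ℝ :=
  16 * (coeff11 (fun a => ∫ p, v p * coeff22 (fun b => leviForm φ b p) ∂(leviMeasure Ω v a))
    + coeff22 (fun a => ∫ p, v p * coeff11 (fun b => leviForm φ b p) ∂(leviMeasure Ω v a))
    - 2 * coeffRe12
        (fun a => ∫ p, v p * coeffRe12 (fun b => leviForm φ b p) ∂(leviMeasure Ω v a))
    - 2 * coeffIm12
        (fun a => ∫ p, v p * coeffIm12 (fun b => leviForm φ b p) ∂(leviMeasure Ω v a)))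

/-- The punctured unit bidisc `Δ² \ {(0, 0)}`. -/
def puncturedBidisc : Opens (ℂ × ℂ) where
  carrier := (Metric.ball 0 1 ×ˢ Metric.ball 0 1) \ {0}
  is_open' := (Metric.isOpen_ball.prod Metric.isOpen_ball).sdiff isClosed_singleton

/-- The function `u = -√(log |z| log |w|)`, with the value `-∞` on the coordinate axes. -/
def blockiFun (p : ℂ × ℂ) : EReal :=
  if p.1 = 0 ∨ p.2 = 0 then ⊥ else ((-√(Real.log ‖p.1‖ * Real.log ‖p.2‖) : ℝ) : EReal)

/-- A non-decreasing function `χ` on `(-∞, 0)` that is bounded below, extended to `[-∞, 0)` by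
`χ (-∞) = lim_{t → -∞} χ t = inf χ`. -/
def extendBot (χ : ℝ → ℝ) (x : EReal) : ℝ :=
  if x = ⊥ then sInf (χ '' Set.Iio 0) else χ x.toReal

end

/-
Pair `(dd^c g(u))²` with the test function `α(log|z|) B(u)`, where `B` is a smooth decreasing
cutoff equal to `1` near `-∞`. In the coordinates `x = log|z|`, `t = u` the pairing separates
into one-variable integrals, and integration by parts leaves, for a smooth convex weight `g`,
`2π² (∫ α(x) dx / |x|) (∫ g'(t)² (-B'(t)) dt)`. Since `g'² ≥ 2g' - 1` and `-B' ≥ 0` has integral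
one, this is at least `2π² (∫ α(x) dx / |x|) (2 ∫ g B'' - 1)`. The lower bound is affine in `g`, so
it survives the passage from smooth to arbitrary convex weights, and then the limit `χ_m(t) → t`,
where it becomes `2π² ∫ α(x) dx / |x| > 0` because `∫ t B''(t) dt = 1`.
-/

open Set
open scoped ContDiff Convolution CompactlySupported Manifold

/-! ### Measures on an open set and test functions -/

section TestFunctions

variable {E : Type*} [NormedAddCommGroup E] {Ω : Opens E}

/-- The continuous functions with compact support contained in `Ω`, as functions on the whole
space. -/
structure CompactlySupportedIn (Ω : Opens E) (ψ : E → ℝ) : Prop where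
  continuous : Continuous ψ
  hasCompactSupport : HasCompactSupport ψ
  tsupport_subset : tsupport ψ ⊆ Ω

namespace CompactlySupportedIn

variable {ψ : E → ℝ}

theorem of_tsupport_subset {f : E → ℝ} (hψ : CompactlySupportedIn Ω ψ) (hf : Continuous f)
    (hfψ : tsupport f ⊆ tsupport ψ) : CompactlySupportedIn Ω f :=
  ⟨hf, hψ.hasCompactSupport.of_isClosed_subset (isClosed_tsupport f) hfψ,
    hfψ.trans hψ.tsupport_subset⟩

theorem mul_left {v : E → ℝ} (hψ : CompactlySupportedIn Ω ψ) (hv : ContinuousOn v Ω) :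
    CompactlySupportedIn Ω fun x => v x * ψ x :=
  hψ.of_tsupport_subset
    ((hv.mul hψ.continuous.continuousOn).continuous_of_tsupport_subset Ω.isOpen
      (tsupport_mul_subset_right.trans hψ.tsupport_subset)) tsupport_mul_subset_right

end CompactlySupportedIn

theorem eq_zero_of_tsupport_subset {f : E → ℝ} {s : Set E} (hf : tsupport f ⊆ s) {x : E}
    (hx : x ∉ s) : f x = 0 :=
  image_eq_zero_of_notMem_tsupport fun h => hx (hf h)

theorem tendstoUniformly_mul_of_tendstoLocallyUniformlyOn {ι : Type*} {l : Filter ι}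
    {v ψ : E → ℝ} {w : ι → E → ℝ} (hwv : TendstoLocallyUniformlyOn w v l Ω)
    (hψ : CompactlySupportedIn Ω ψ) :
    TendstoUniformly (fun n x => w n x * ψ x) (fun x => v x * ψ x) l := by
  obtain ⟨C, hC⟩ := hψ.hasCompactSupport.exists_bound_of_continuous hψ.continuous
  have hK : TendstoUniformlyOn w v l (tsupport ψ) :=
    (tendstoLocallyUniformlyOn_iff_tendstoUniformlyOn_of_compact hψ.hasCompactSupport).1
      (hwv.mono hψ.tsupport_subset)
  rw [Metric.tendstoUniformly_iff]
  intro ε hε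
  filter_upwards [Metric.tendstoUniformlyOn_iff.1 hK (ε / (|C| + 1)) (by positivity)] with n hn x
  by_cases hx : x ∈ tsupport ψ
  · have hψx : |ψ x| ≤ |C| + 1 := by linarith [Real.norm_eq_abs (ψ x) ▸ hC x, le_abs_self C]
    calc dist (v x * ψ x) (w n x * ψ x) = dist (v x) (w n x) * |ψ x| := by
          rw [Real.dist_eq, Real.dist_eq, ← sub_mul, abs_mul]
      _ ≤ dist (v x) (w n x) * (|C| + 1) := by gcongr
      _ < ε / (|C| + 1) * (|C| + 1) := by gcongr; exact hn x hx
      _ = ε := div_mul_cancel₀ _ (by positivity)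
  · simpa [image_eq_zero_of_notMem_tsupport hx] using hε

section Smooth

variable [NormedSpace ℝ E]

theorem compactlySupportedIn_testFunction (φ : 𝓓(Ω, ℝ)) : CompactlySupportedIn Ω φ :=
  ⟨φ.continuous, φ.hasCompactSupport, φ.tsupport_subset⟩

theorem contDiff_two_testFunction (φ : 𝓓(Ω, ℝ)) : ContDiff ℝ 2 φ :=
  φ.contDiff.of_le (WithTop.coe_le_coe.2 le_top)

theorem exists_testFunction_eq_one [FiniteDimensional ℝ E] {K : Set E} (hK : IsCompact K)
    (hKΩ : K ⊆ Ω) :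
    ∃ ρ : 𝓓(Ω, ℝ), (∀ x, 0 ≤ ρ x) ∧ ∀ x ∈ K, ρ x = 1 := by
  obtain ⟨L, hL, hKL, hLΩ⟩ := exists_compact_between hK Ω.isOpen hKΩ
  obtain ⟨f, hf0, hf1, hf⟩ := exists_contMDiffMap_zero_one_of_isClosed (n := ⊤) 𝓘(ℝ, E)
    (s := (interior L)ᶜ) (t := K) isOpen_interior.isClosed_compl hK.isClosed
    (disjoint_left.2 fun x hx hx' => hx (hKL hx'))
  have hfL : tsupport f ⊆ L :=
    closure_minimal (fun x hx => interior_subset (by_contra fun h => hx (hf0 h))) hL.isClosed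
  exact ⟨⟨f, f.contMDiff.contDiff, hL.of_isClosed_subset (isClosed_tsupport _) hfL,
    hfL.trans hLΩ⟩, fun x => (hf x).1, fun x hx => hf1 hx⟩

end Smooth

variable [MeasurableSpace E]

/-- The measure `μ` is finite on the compact subsets of `Ω`. Measures on `Ω` are regarded as
measures on the whole space, so local finiteness near the boundary of `Ω` is not required. -/
def IsRadonOn (Ω : Opens E) (μ : Measure E) : Prop :=
  ∀ K : Set E, K ⊆ Ω → IsCompact K → μ K < ⊤

theorem isRadonOn_of_isFiniteMeasureOnCompacts (μ : Measure E) [IsFiniteMeasureOnCompacts μ] :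
    IsRadonOn Ω μ :=
  fun _ _ hK => hK.measure_lt_top

variable [BorelSpace E]

theorem IsRadonOn.integrable {μ : Measure E} (hμ : IsRadonOn Ω μ) {f : E → ℝ}
    (hf : CompactlySupportedIn Ω f) : Integrable f μ := by
  obtain ⟨C, hC⟩ := hf.hasCompactSupport.exists_bound_of_continuous hf.continuous
  rw [← integrableOn_iff_integrable_of_support_subset (subset_tsupport f)]
  exact Measure.integrableOn_of_bounded (hμ _ hf.tsupport_subset hf.hasCompactSupport).ne
    hf.continuous.aestronglyMeasurable (ae_of_all _ hC)

theorem CompactlySupportedIn.integrable {ψ : E → ℝ} (hψ : CompactlySupportedIn Ω ψ)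
    (μ : Measure E) [IsFiniteMeasureOnCompacts μ] : Integrable ψ μ :=
  hψ.continuous.integrable_of_hasCompactSupport hψ.hasCompactSupport

theorem CompactlySupportedIn.integrable_mul_left {v ψ : E → ℝ} (hψ : CompactlySupportedIn Ω ψ)
    (hv : ContinuousOn v Ω) (μ : Measure E) [IsFiniteMeasureOnCompacts μ] :
    Integrable (fun x => v x * ψ x) μ :=
  (hψ.mul_left hv).integrable μ

variable [NormedSpace ℝ E]

theorem IsRadonOn.abs_integral_sub_integral_le {μ : Measure E} (hμ : IsRadonOn Ω μ) {K : Set E}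
    (hK : IsCompact K) (hKΩ : K ⊆ Ω) {ρ : 𝓓(Ω, ℝ)} (hρ : ∀ x, 0 ≤ ρ x) (hρK : ∀ x ∈ K, ρ x = 1)
    {f g : E → ℝ} (hf : Continuous f) (hg : Continuous g) (hfK : tsupport f ⊆ K)
    (hgK : tsupport g ⊆ K) {c : ℝ} (hc : 0 ≤ c) (hfg : ∀ x, |f x - g x| ≤ c) :
    |∫ x, f x ∂μ - ∫ x, g x ∂μ| ≤ c * ∫ x, ρ x ∂μ := by
  have integrable_of_tsupport {h : E → ℝ} (hh : Continuous h) (hhK : tsupport h ⊆ K) :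
      Integrable h μ :=
    hμ.integrable ⟨hh, hK.of_isClosed_subset (isClosed_tsupport _) hhK, hhK.trans hKΩ⟩
  rw [← integral_sub (integrable_of_tsupport hf hfK) (integrable_of_tsupport hg hgK),
    ← integral_const_mul, ← Real.norm_eq_abs]
  refine norm_integral_le_of_norm_le
    ((hμ.integrable (compactlySupportedIn_testFunction ρ)).const_mul c)
    (ae_of_all _ fun x => ?_)
  by_cases hx : x ∈ K
  · simpa [hρK x hx] using hfg x
  · simpa [eq_zero_of_tsupport_subset hfK hx, eq_zero_of_tsupport_subset hgK hx]
      using mul_nonneg hc (hρ x)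

section VagueConvergence

variable [FiniteDimensional ℝ E] {ι : Type*} {l : Filter ι} {μ : Measure E} {ν : ι → Measure E}

theorem tendsto_integral_of_forall_testFunction (hμ : IsRadonOn Ω μ) (hν : ∀ n, IsRadonOn Ω (ν n))
    (hνμ : ∀ φ : 𝓓(Ω, ℝ), Tendsto (fun n => ∫ x, φ x ∂(ν n)) l (𝓝 (∫ x, φ x ∂μ)))
    {f : E → ℝ} (hf : CompactlySupportedIn Ω f) :
    Tendsto (fun n => ∫ x, f x ∂(ν n)) l (𝓝 (∫ x, f x ∂μ)) := by
  obtain ⟨ρ, hρ, hρK⟩ := exists_testFunction_eq_one hf.hasCompactSupport hf.tsupport_subset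
  have hM : 0 ≤ ∫ x, ρ x ∂μ := integral_nonneg hρ
  set M := ∫ x, ρ x ∂μ
  rw [Metric.tendsto_nhds]
  intro ε hε
  obtain ⟨δ, hδ, hδε⟩ : ∃ δ > 0, δ * (2 * M + 1) + δ < ε :=
    ⟨ε / (2 * M + 3), by positivity, by
      rw [← mul_add_one, div_mul_eq_mul_div, div_lt_iff₀ (by positivity)]; nlinarith⟩
  obtain ⟨h, hh, hhf, hsupp⟩ := hf.continuous.exists_contDiff_approx ⊤ (ε := fun _ => δ)
    continuous_const (fun _ => hδ)
  have hhK : tsupport h ⊆ tsupport f := closure_mono hsupp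
  have hhΩ := hf.of_tsupport_subset hh.continuous hhK
  let H : 𝓓(Ω, ℝ) := ⟨h, hh, hhΩ.hasCompactSupport, hhΩ.tsupport_subset⟩
  have close {κ : Measure E} (hκ : IsRadonOn Ω κ) :
      |∫ x, h x ∂κ - ∫ x, f x ∂κ| ≤ δ * ∫ x, ρ x ∂κ :=
    hκ.abs_integral_sub_integral_le hf.hasCompactSupport hf.tsupport_subset hρ hρK hh.continuous
      hf.continuous hhK subset_rfl hδ.le fun x => (Real.dist_eq _ _ ▸ hhf x).le
  filter_upwards [Metric.tendsto_nhds.1 (hνμ H) δ hδ, (hνμ ρ).eventually_lt_const (lt_add_one M)]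
    with n hHn hρn
  have hHn' : |∫ x, h x ∂(ν n) - ∫ x, h x ∂μ| < δ := hHn
  have hνn := (close (hν n)).trans (mul_le_mul_of_nonneg_left hρn.le hδ.le)
  rw [Real.dist_eq]
  rw [abs_sub_comm] at hνn
  linarith [abs_sub_le (∫ x, f x ∂(ν n)) (∫ x, h x ∂(ν n)) (∫ x, f x ∂μ),
    abs_sub_le (∫ x, h x ∂(ν n)) (∫ x, h x ∂μ) (∫ x, f x ∂μ), close hμ]

theorem tendsto_integral_of_tendstoUniformly (hμ : IsRadonOn Ω μ) (hν : ∀ n, IsRadonOn Ω (ν n))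
    (hνμ : ∀ φ : 𝓓(Ω, ℝ), Tendsto (fun n => ∫ x, φ x ∂(ν n)) l (𝓝 (∫ x, φ x ∂μ)))
    {K : Set E} (hK : IsCompact K) (hKΩ : K ⊆ Ω) {f : E → ℝ} {g : ι → E → ℝ} (hf : Continuous f)
    (hg : ∀ n, Continuous (g n)) (hfK : tsupport f ⊆ K) (hgK : ∀ n, tsupport (g n) ⊆ K)
    (hgf : TendstoUniformly g f l) :
    Tendsto (fun n => ∫ x, g n x ∂(ν n)) l (𝓝 (∫ x, f x ∂μ)) := by
  obtain ⟨ρ, hρ, hρK⟩ := exists_testFunction_eq_one hK hKΩ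
  have hM : 0 ≤ ∫ x, ρ x ∂μ := integral_nonneg hρ
  set M := ∫ x, ρ x ∂μ
  refine (tendsto_integral_of_forall_testFunction hμ hν hνμ
    ⟨hf, hK.of_isClosed_subset (isClosed_tsupport _) hfK, hfK.trans hKΩ⟩).congr_dist ?_
  rw [Metric.tendsto_nhds]
  intro ε hε
  filter_upwards [Metric.tendstoUniformly_iff.1 hgf (ε / (M + 2)) (by positivity),
    (hνμ ρ).eventually_lt_const (lt_add_one M)] with n hgn hρn
  have close : |∫ x, f x ∂(ν n) - ∫ x, g n x ∂(ν n)| ≤ ε / (M + 2) * ∫ x, ρ x ∂(ν n) :=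
    (hν n).abs_integral_sub_integral_le hK hKΩ hρ hρK hf (hg n) hfK (hgK n) (by positivity)
      fun x => (Real.dist_eq _ _ ▸ hgn x).le
  rw [Real.dist_eq, sub_zero, abs_of_nonneg dist_nonneg, Real.dist_eq]
  calc |∫ x, f x ∂(ν n) - ∫ x, g n x ∂(ν n)| ≤ ε / (M + 2) * (M + 1) :=
        close.trans (by gcongr)
    _ < ε := by rw [div_mul_eq_mul_div, div_lt_iff₀ (by positivity)]; nlinarith

theorem tendsto_integral_mul_of_tendstoLocallyUniformlyOn (hμ : IsRadonOn Ω μ)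
    (hν : ∀ n, IsRadonOn Ω (ν n))
    (hνμ : ∀ φ : 𝓓(Ω, ℝ), Tendsto (fun n => ∫ x, φ x ∂(ν n)) l (𝓝 (∫ x, φ x ∂μ)))
    {v ψ : E → ℝ} {w : ι → E → ℝ} (hv : ContinuousOn v Ω) (hw : ∀ n, ContinuousOn (w n) Ω)
    (hwv : TendstoLocallyUniformlyOn w v l Ω) (hψ : CompactlySupportedIn Ω ψ) :
    Tendsto (fun n => ∫ x, w n x * ψ x ∂(ν n)) l (𝓝 (∫ x, v x * ψ x ∂μ)) :=
  tendsto_integral_of_tendstoUniformly hμ hν hνμ hψ.hasCompactSupport hψ.tsupport_subset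
    (hψ.mul_left hv).continuous (fun n => (hψ.mul_left (hw n)).continuous)
    tsupport_mul_subset_right (fun _ => tsupport_mul_subset_right)
    (tendstoUniformly_mul_of_tendstoLocallyUniformlyOn hwv hψ)

theorem integral_eq_of_forall_testFunction {μ' : Measure E} (hμ : IsRadonOn Ω μ)
    (hμ' : IsRadonOn Ω μ') (h : ∀ φ : 𝓓(Ω, ℝ), ∫ x, φ x ∂μ' = ∫ x, φ x ∂μ) {f : E → ℝ}
    (hf : CompactlySupportedIn Ω f) : ∫ x, f x ∂μ' = ∫ x, f x ∂μ :=
  tendsto_nhds_unique (l := (atTop : Filter ℕ)) tendsto_const_nhds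
    (tendsto_integral_of_forall_testFunction (ν := fun _ => μ') hμ (fun _ => hμ')
      (fun φ => h φ ▸ tendsto_const_nhds) hf)

end VagueConvergence

end TestFunctions

section PositiveFunctionals

variable {E : Type*} [NormedAddCommGroup E] [NormedSpace ℝ E]

/-- The restriction of a test function to the open set that carries it, as a linear map into the
continuous functions with compact support on that open set. -/
noncomputable def testRestrict (Ω : Opens E) : 𝓓(Ω, ℝ) →ₗ[ℝ] C_c(Ω, ℝ) where
  toFun φ :=
    { toFun := fun x => φ x
      continuous_toFun := φ.continuous.comp continuous_subtype_val
      hasCompactSupport' := by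
        have hK : IsCompact ((↑) ⁻¹' tsupport φ : Set Ω) :=
          (IsInducing.subtypeVal.isCompact_preimage_iff
            (by simpa using φ.tsupport_subset)).2 φ.hasCompactSupport
        exact HasCompactSupport.of_support_subset_isCompact hK fun x hx => subset_tsupport _ hx }
  map_add' _ _ := rfl
  map_smul' _ _ := rfl

variable {Ω : Opens E}

theorem nonneg_of_testRestrict_nonneg {φ : 𝓓(Ω, ℝ)} (h : 0 ≤ testRestrict Ω φ) (x : E) :
    0 ≤ φ x := by
  by_cases hx : x ∈ Ω
  · exact h ⟨x, hx⟩
  · exact (eq_zero_of_tsupport_subset φ.tsupport_subset hx).ge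

theorem testRestrict_injective : Function.Injective (testRestrict Ω) := by
  intro φ ψ h
  ext x
  by_cases hx : x ∈ Ω
  · exact congrArg (fun f : C_c(Ω, ℝ) => f ⟨x, hx⟩) h
  · rw [eq_zero_of_tsupport_subset φ.tsupport_subset hx,
      eq_zero_of_tsupport_subset ψ.tsupport_subset hx]

variable [FiniteDimensional ℝ E]

theorem exists_le_testRestrict (f : C_c(Ω, ℝ)) : ∃ φ : 𝓓(Ω, ℝ), f ≤ testRestrict Ω φ := by
  obtain ⟨C, hC⟩ := f.hasCompactSupport.exists_bound_of_continuous f.continuous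
  obtain ⟨ρ, hρ, hρK⟩ := exists_testFunction_eq_one (Ω := Ω) (K := Subtype.val '' tsupport f)
    (f.hasCompactSupport.isCompact.image continuous_subtype_val)
    (by rintro _ ⟨x, -, rfl⟩; exact x.2)
  refine ⟨|C| • ρ, fun x => ?_⟩
  change f x ≤ |C| * ρ x
  by_cases hx : x ∈ tsupport f
  · rw [hρK x ⟨x, hx, rfl⟩, mul_one]
    exact (le_abs_self _).trans ((hC x).trans (le_abs_self C))
  · rw [image_eq_zero_of_notMem_tsupport hx]
    exact mul_nonneg (abs_nonneg C) (hρ x)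

theorem exists_positiveLinearMap_extends {Λ : 𝓓(Ω, ℝ) →ₗ[ℝ] ℝ}
    (hΛ : ∀ φ : 𝓓(Ω, ℝ), (∀ x, 0 ≤ φ x) → 0 ≤ Λ φ) :
    ∃ P : C_c(Ω, ℝ) →ₚ[ℝ] ℝ, ∀ φ, P (testRestrict Ω φ) = Λ φ := by
  let e := LinearEquiv.ofInjective (testRestrict Ω) testRestrict_injective
  let Λrange : C_c(Ω, ℝ) →ₗ.[ℝ] ℝ :=
    ⟨LinearMap.range (testRestrict Ω), Λ ∘ₗ e.symm.toLinearMap⟩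
  have hΛrange (φ : 𝓓(Ω, ℝ)) : Λrange (e φ) = Λ φ := congrArg Λ (e.symm_apply_apply φ)
  have : PosSMulMono ℝ C_c(Ω, ℝ) := ⟨fun _ hc _ _ h x => mul_le_mul_of_nonneg_left (h x) hc⟩
  obtain ⟨g, hgΛ, hg⟩ := riesz_extension (PointedCone.positive ℝ C_c(Ω, ℝ)) Λrange
    (fun x hx => by
      obtain ⟨φ, rfl⟩ := e.surjective x
      exact (hΛrange φ).ge.trans' (hΛ φ (nonneg_of_testRestrict_nonneg hx)))
    (fun f => by
      obtain ⟨φ, hφ⟩ := exists_le_testRestrict (-f)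
      exact ⟨e φ, neg_le_iff_add_nonneg.1 hφ⟩)
  exact ⟨PositiveLinearMap.mk₀ g fun f hf => hg f hf,
    fun φ => (hgΛ (e φ)).trans (hΛrange φ)⟩

theorem exists_measure_of_nonneg [MeasurableSpace E] [BorelSpace E] {Λ : 𝓓(Ω, ℝ) →ₗ[ℝ] ℝ}
    (hΛ : ∀ φ : 𝓓(Ω, ℝ), (∀ x, 0 ≤ φ x) → 0 ≤ Λ φ) :
    ∃ μ : Measure E, μ (Ω : Set E)ᶜ = 0 ∧ IsRadonOn Ω μ ∧ ∀ φ : 𝓓(Ω, ℝ), ∫ x, φ x ∂μ = Λ φ := by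
  obtain ⟨P, hP⟩ := exists_positiveLinearMap_extends hΛ
  have : LocallyCompactSpace Ω := Ω.isOpen.locallyCompactSpace
  have hemb : MeasurableEmbedding ((↑) : Ω → E) := .subtype_coe Ω.isOpen.measurableSet
  refine ⟨(RealRMK.rieszMeasure P).map (↑), ?_, fun K hKΩ hK => ?_, fun φ => ?_⟩
  · rw [hemb.map_apply, preimage_compl, Subtype.coe_preimage_self, compl_univ, measure_empty]
  · have hK' : IsCompact ((↑) ⁻¹' K : Set Ω) :=
      (IsInducing.subtypeVal.isCompact_preimage_iff (by simpa using hKΩ)).2 hK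
    rw [hemb.map_apply]
    exact hK'.measure_lt_top
  · rw [hemb.integral_map]
    exact (RealRMK.integral_rieszMeasure P (testRestrict Ω φ)).trans (hP φ)

end PositiveFunctionals

/-! ### Second derivatives and the Levi form -/

section SecondDerivatives

variable {E : Type*} [NormedAddCommGroup E] [NormedSpace ℝ E]

theorem contDiffAt_fderiv_apply {f : E → ℝ} {x : E} (hf : ContDiffAt ℝ 2 f x) (a : E) :
    ContDiffAt ℝ 1 (fun y => fderiv ℝ f y a) x :=
  (hf.fderiv_right (m := 1) (by norm_num)).clm_apply contDiffAt_const

theorem differentiableAt_fderiv {f : E → ℝ} {x : E} (hf : ContDiffAt ℝ 2 f x) :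
    DifferentiableAt ℝ (fderiv ℝ f) x :=
  (hf.fderiv_right (m := 1) (by norm_num)).differentiableAt (by norm_num)

theorem fderiv_fderiv_apply {f : E → ℝ} {x : E} (hf : ContDiffAt ℝ 2 f x) (a b : E) :
    fderiv ℝ (fun y => fderiv ℝ f y a) x b = fderiv ℝ (fderiv ℝ f) x b a := by
  rw [fderiv_clm_apply (differentiableAt_fderiv hf) (differentiableAt_const a)]
  simp

theorem continuousAt_fderiv_fderiv_apply {f : E → ℝ} {x : E} (hf : ContDiffAt ℝ 2 f x) (a b : E) :
    ContinuousAt (fun y => fderiv ℝ (fderiv ℝ f) y a b) x :=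
  ((((hf.fderiv_right (m := 1) (by norm_num)).fderiv_right (m := 0) (by norm_num)).clm_apply
    contDiffAt_const).clm_apply contDiffAt_const).continuousAt

theorem tsupport_fderiv_fderiv_apply_subset (f : E → ℝ) (a b : E) :
    tsupport (fun y => fderiv ℝ (fderiv ℝ f) y a b) ⊆ tsupport f := by
  refine closure_minimal (fun y hy => ?_) (isClosed_tsupport f)
  contrapose! hy
  have hzero : fderiv ℝ (fderiv ℝ f) y = 0 := image_eq_zero_of_notMem_tsupport fun h =>
    hy (tsupport_fderiv_subset ℝ (tsupport_fderiv_subset ℝ h))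
  simp [hzero]

variable [FiniteDimensional ℝ E] [MeasurableSpace E] [BorelSpace E] {Ω : Opens E} {v φ : E → ℝ}
  (μ : Measure E) [μ.IsAddHaarMeasure]

theorem integral_mul_fderiv_apply (hv : ContDiffOn ℝ 1 v Ω) (hφ : ContDiff ℝ 1 φ)
    (hφc : HasCompactSupport φ) (hφΩ : tsupport φ ⊆ Ω) (a : E) :
    ∫ x, v x * fderiv ℝ φ x a ∂μ = -∫ x, fderiv ℝ v x a * φ x ∂μ := by
  have hvat (x) (hx : x ∈ Ω) : ContDiffAt ℝ 1 v x := hv.contDiffAt (Ω.isOpen.mem_nhds hx)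
  have hv' : ContinuousOn (fun x => fderiv ℝ v x a) Ω := fun x hx =>
    (((hvat x hx).fderiv_right (m := 0) (by norm_num)).continuousAt.clm_apply
      continuousAt_const).continuousWithinAt
  have hφ' : Continuous fun x => fderiv ℝ φ x a :=
    ((hφ.fderiv_right (m := 0) (by norm_num)).clm_apply contDiff_const).continuous
  have hφcs : CompactlySupportedIn Ω φ := ⟨hφ.continuous, hφc, hφΩ⟩
  exact integral_mul_fderiv_eq_neg_fderiv_mul_of_integrable (hφcs.integrable_mul_left hv' μ)
    ((hφcs.of_tsupport_subset hφ' (tsupport_fderiv_apply_subset ℝ a)).integrable_mul_left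
      hv.continuousOn μ)
    (hφcs.integrable_mul_left hv.continuousOn μ)
    (fun x hx => (hvat x (hφΩ hx)).differentiableAt one_ne_zero)
    (fun x _ => hφ.contDiffAt.differentiableAt one_ne_zero)

theorem integral_mul_fderiv_fderiv_apply (hv : ContDiffOn ℝ 2 v Ω) (hφ : ContDiff ℝ 2 φ)
    (hφc : HasCompactSupport φ) (hφΩ : tsupport φ ⊆ Ω) (a : E) :
    ∫ x, v x * fderiv ℝ (fderiv ℝ φ) x a a ∂μ = ∫ x, fderiv ℝ (fderiv ℝ v) x a a * φ x ∂μ := by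
  have hvat (x) (hx : x ∈ Ω) : ContDiffAt ℝ 2 v x := hv.contDiffAt (Ω.isOpen.mem_nhds hx)
  have hv' : ContDiffOn ℝ 1 (fun x => fderiv ℝ v x a) Ω := fun x hx =>
    (contDiffAt_fderiv_apply (hvat x hx) a).contDiffWithinAt
  have hφ' : ContDiff ℝ 1 fun x => fderiv ℝ φ x a :=
    contDiff_iff_contDiffAt.2 fun x => contDiffAt_fderiv_apply hφ.contDiffAt a
  calc ∫ x, v x * fderiv ℝ (fderiv ℝ φ) x a a ∂μ
      = ∫ x, v x * fderiv ℝ (fun y => fderiv ℝ φ y a) x a ∂μ := by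
        simp only [fderiv_fderiv_apply hφ.contDiffAt]
    _ = -∫ x, fderiv ℝ v x a * fderiv ℝ φ x a ∂μ :=
        integral_mul_fderiv_apply μ (hv.of_le one_le_two) hφ' (hφc.fderiv_apply ℝ a)
          ((tsupport_fderiv_apply_subset ℝ a).trans hφΩ) a
    _ = ∫ x, fderiv ℝ (fun y => fderiv ℝ v y a) x a * φ x ∂μ := by
        rw [integral_mul_fderiv_apply μ hv' (hφ.of_le one_le_two) hφc hφΩ a, neg_neg]
    _ = ∫ x, fderiv ℝ (fderiv ℝ v) x a a * φ x ∂μ := by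
        refine integral_congr_ae (ae_of_all _ fun x => ?_)
        by_cases hx : x ∈ Ω
        · simp only [fderiv_fderiv_apply (hvat x hx)]
        · simp only [eq_zero_of_tsupport_subset hφΩ hx, mul_zero]

end SecondDerivatives

section LeviForm

theorem leviForm_congr {f g : ℂ × ℂ → ℝ} {p : ℂ × ℂ} (h : f =ᶠ[𝓝 p] g) (a : ℂ × ℂ) :
    leviForm f a p = leviForm g a p := by
  simp only [leviForm, (h.fderiv (𝕜 := ℝ)).fderiv_eq]

theorem continuousAt_leviForm {f : ℂ × ℂ → ℝ} {p : ℂ × ℂ} (hf : ContDiffAt ℝ 2 f p)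
    (a : ℂ × ℂ) : ContinuousAt (leviForm f a) p :=
  ((continuousAt_fderiv_fderiv_apply hf a a).add
    (continuousAt_fderiv_fderiv_apply hf (Complex.I • a) (Complex.I • a))).div_const 4

theorem continuous_leviForm {f : ℂ × ℂ → ℝ} (hf : ContDiff ℝ 2 f) (a : ℂ × ℂ) :
    Continuous (leviForm f a) :=
  continuous_iff_continuousAt.2 fun _ => continuousAt_leviForm hf.contDiffAt a

theorem tsupport_leviForm_subset (f : ℂ × ℂ → ℝ) (a : ℂ × ℂ) :
    tsupport (leviForm f a) ⊆ tsupport f := by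
  refine closure_minimal (fun p hp => ?_) (isClosed_tsupport f)
  contrapose! hp
  have hzero (b : ℂ × ℂ) : fderiv ℝ (fderiv ℝ f) p b b = 0 :=
    eq_zero_of_tsupport_subset (tsupport_fderiv_fderiv_apply_subset f b b) hp
  simp [leviForm, hzero]

theorem leviForm_add {f g : ℂ × ℂ → ℝ} {p : ℂ × ℂ} (hf : ContDiffAt ℝ 2 f p)
    (hg : ContDiffAt ℝ 2 g p) (a : ℂ × ℂ) :
    leviForm (fun q => f q + g q) a p = leviForm f a p + leviForm g a p := by
  have h1 : fderiv ℝ (fun q => f q + g q) =ᶠ[𝓝 p] fun q => fderiv ℝ f q + fderiv ℝ g q := by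
    filter_upwards [hf.eventually (by simp), hg.eventually (by simp)] with q hq hq'
    exact fderiv_fun_add (hq.differentiableAt two_ne_zero) (hq'.differentiableAt two_ne_zero)
  simp only [leviForm, h1.fderiv_eq,
    fderiv_fun_add (differentiableAt_fderiv hf) (differentiableAt_fderiv hg), add_apply]
  ring

theorem leviForm_const_mul (c : ℝ) (f : ℂ × ℂ → ℝ) (a p : ℂ × ℂ) :
    leviForm (fun q => c * f q) a p = c * leviForm f a p := by
  have h1 : fderiv ℝ (fun q => c * f q) = c • fderiv ℝ f :=
    funext fun q => congrFun (fderiv_const_smul_field (𝕜 := ℝ) (f := f) c) q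
  have h2 : fderiv ℝ (c • fderiv ℝ f) = c • fderiv ℝ (fderiv ℝ f) :=
    fderiv_const_smul_field (𝕜 := ℝ) (f := fderiv ℝ f) c
  simp only [leviForm, h1, h2, smul_apply, smul_eq_mul, Pi.smul_apply]
  ring

instance isAddHaarMeasure_volume_complex_prod :
    (volume : Measure (ℂ × ℂ)).IsAddHaarMeasure :=
  inferInstanceAs ((volume : Measure ℂ).prod (volume : Measure ℂ)).IsAddHaarMeasure

variable {Ω : Opens (ℂ × ℂ)} {v : ℂ × ℂ → ℝ}

theorem continuousOn_leviForm (hv : ContDiffOn ℝ 2 v Ω) (a : ℂ × ℂ) :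
    ContinuousOn (leviForm v a) Ω :=
  fun _ hp => (continuousAt_leviForm (hv.contDiffAt (Ω.isOpen.mem_nhds hp)) a).continuousWithinAt

theorem compactlySupportedIn_leviForm (φ : 𝓓(Ω, ℝ)) (a : ℂ × ℂ) :
    CompactlySupportedIn Ω (leviForm φ a) :=
  (compactlySupportedIn_testFunction φ).of_tsupport_subset
    (continuous_leviForm (contDiff_two_testFunction φ) a) (tsupport_leviForm_subset φ a)

theorem integrable_mul_leviForm (hv : ContinuousOn v Ω) (φ : 𝓓(Ω, ℝ)) (a : ℂ × ℂ) :
    Integrable fun p => v p * leviForm φ a p :=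
  (compactlySupportedIn_leviForm φ a).integrable_mul_left hv _

theorem setIntegral_mul_leviForm (v : ℂ × ℂ → ℝ) (φ : 𝓓(Ω, ℝ)) (a : ℂ × ℂ) :
    ∫ p in (Ω : Set (ℂ × ℂ)), v p * leviForm φ a p = ∫ p, v p * leviForm φ a p := by
  refine setIntegral_eq_integral_of_forall_compl_eq_zero fun p hp => ?_
  rw [eq_zero_of_tsupport_subset (compactlySupportedIn_leviForm φ a).tsupport_subset hp, mul_zero]

theorem integral_mul_leviForm (hv : ContDiffOn ℝ 2 v Ω) (φ : 𝓓(Ω, ℝ)) (a : ℂ × ℂ) :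
    ∫ p, v p * leviForm φ a p = ∫ p, leviForm v a p * φ p := by
  have hφ := contDiff_two_testFunction φ
  have integrable_left (b) : Integrable fun p => v p * fderiv ℝ (fderiv ℝ φ) p b b :=
    ((compactlySupportedIn_testFunction φ).of_tsupport_subset
      (continuous_iff_continuousAt.2 fun _ => continuousAt_fderiv_fderiv_apply hφ.contDiffAt b b)
      (tsupport_fderiv_fderiv_apply_subset φ b b)).integrable_mul_left hv.continuousOn _
  have integrable_right (b) : Integrable fun p => fderiv ℝ (fderiv ℝ v) p b b * φ p :=
    (compactlySupportedIn_testFunction φ).integrable_mul_left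
      (fun p hp => (continuousAt_fderiv_fderiv_apply
        (hv.contDiffAt (Ω.isOpen.mem_nhds hp)) b b).continuousWithinAt) _
  have parts (b) := integral_mul_fderiv_fderiv_apply volume hv hφ φ.hasCompactSupport
    φ.tsupport_subset b
  simp only [leviForm, mul_div_assoc', div_mul_eq_mul_div, mul_add, add_mul, integral_div]
  rw [integral_add (integrable_left _) (integrable_left _),
    integral_add (integrable_right _) (integrable_right _), parts, parts]

end LeviForm

section LeviMeasure

variable {Ω : Opens (ℂ × ℂ)} {v : ℂ × ℂ → ℝ} {a : ℂ × ℂ}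

/-- The distribution `∑ a_j (conj a_k) ∂²v/∂z_j∂z̄_k` on `Ω`, for a continuous `v`. -/
noncomputable def leviDistribution (hv : ContinuousOn v Ω) (a : ℂ × ℂ) : 𝓓(Ω, ℝ) →ₗ[ℝ] ℝ where
  toFun φ := ∫ p, v p * leviForm φ a p
  map_add' φ ψ := by
    rw [← integral_add (integrable_mul_leviForm hv φ a) (integrable_mul_leviForm hv ψ a)]
    refine integral_congr_ae (ae_of_all _ fun p => ?_)
    simp only [← mul_add]
    rw [← leviForm_add (contDiff_two_testFunction φ).contDiffAt
      (contDiff_two_testFunction ψ).contDiffAt]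
    rfl
  map_smul' c φ := by
    rw [RingHom.id_apply, smul_eq_mul, ← integral_const_mul]
    refine integral_congr_ae (ae_of_all _ fun p => ?_)
    beta_reduce
    rw [mul_left_comm c (v p), ← leviForm_const_mul c]
    rfl

theorem exists_isLeviMeasure (hv : ContinuousOn v Ω)
    (hpos : ∀ φ : 𝓓(Ω, ℝ), (∀ p, 0 ≤ φ p) → 0 ≤ ∫ p, v p * leviForm φ a p) :
    ∃ μ, IsLeviMeasure Ω v a μ := by
  obtain ⟨μ, hμΩ, hμ, hμφ⟩ := exists_measure_of_nonneg (Λ := leviDistribution hv a) hpos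
  exact ⟨μ, hμΩ, hμ, fun φ => (hμφ φ).trans (setIntegral_mul_leviForm v φ a).symm⟩

theorem isLeviMeasure_leviMeasure (hv : HasLeviMeasures Ω v) (a : ℂ × ℂ) :
    IsLeviMeasure Ω v a (leviMeasure Ω v a) := by
  rw [leviMeasure, dif_pos (hv a)]
  exact (hv a).choose_spec

theorem isRadonOn_leviMeasure (hv : HasLeviMeasures Ω v) (a : ℂ × ℂ) :
    IsRadonOn Ω (leviMeasure Ω v a) :=
  (isLeviMeasure_leviMeasure hv a).lt_top_of_isCompact

theorem integral_leviMeasure (hv : HasLeviMeasures Ω v) (φ : 𝓓(Ω, ℝ)) :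
    ∫ p, φ p ∂(leviMeasure Ω v a) = ∫ p, v p * leviForm φ a p :=
  ((isLeviMeasure_leviMeasure hv a).integral_eq φ).trans (setIntegral_mul_leviForm v φ a)

section Convergence

variable {ι : Type*} {l : Filter ι} {w : ι → ℂ × ℂ → ℝ}

theorem tendsto_integral_mul_leviForm (hv : ContinuousOn v Ω) (hw : ∀ n, ContinuousOn (w n) Ω)
    (hwv : TendstoLocallyUniformlyOn w v l Ω) (φ : 𝓓(Ω, ℝ)) (a : ℂ × ℂ) :
    Tendsto (fun n => ∫ p, w n p * leviForm φ a p) l (𝓝 (∫ p, v p * leviForm φ a p)) :=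
  tendsto_integral_mul_of_tendstoLocallyUniformlyOn
    (isRadonOn_of_isFiniteMeasureOnCompacts volume)
    (fun _ => isRadonOn_of_isFiniteMeasureOnCompacts volume) (fun _ => tendsto_const_nhds) hv hw
    hwv (compactlySupportedIn_leviForm φ a)

theorem tendsto_integral_mul_leviMeasure (hv : ContinuousOn v Ω) (hw : ∀ n, ContinuousOn (w n) Ω)
    (hwv : TendstoLocallyUniformlyOn w v l Ω) (hlv : HasLeviMeasures Ω v)
    (hlw : ∀ n, HasLeviMeasures Ω (w n)) {ψ : ℂ × ℂ → ℝ} (hψ : CompactlySupportedIn Ω ψ)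
    (a : ℂ × ℂ) :
    Tendsto (fun n => ∫ p, w n p * ψ p ∂(leviMeasure Ω (w n) a)) l
      (𝓝 (∫ p, v p * ψ p ∂(leviMeasure Ω v a))) := by
  refine tendsto_integral_mul_of_tendstoLocallyUniformlyOn (isRadonOn_leviMeasure hlv a)
    (fun n => isRadonOn_leviMeasure (hlw n) a) (fun φ => ?_) hv hw hwv hψ
  simp only [integral_leviMeasure (hlw _), integral_leviMeasure hlv]
  exact tendsto_integral_mul_leviForm hv hw hwv φ a

/-- The Levi form of `v` is nonnegative almost everywhere on `Ω`, in every direction. -/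
def AELeviNonneg (Ω : Opens (ℂ × ℂ)) (v : ℂ × ℂ → ℝ) : Prop :=
  ∀ a, ∀ᵐ p ∂(volume.restrict (Ω : Set (ℂ × ℂ))), 0 ≤ leviForm v a p

theorem hasLeviMeasures_of_tendstoLocallyUniformlyOn [l.NeBot]
    (hw : ∀ n, ContDiffOn ℝ 2 (w n) Ω) (hpos : ∀ n, AELeviNonneg Ω (w n))
    (hwv : TendstoLocallyUniformlyOn w v l Ω) : HasLeviMeasures Ω v := by
  have hv : ContinuousOn v Ω :=
    hwv.continuousOn (Frequently.of_forall fun n => (hw n).continuousOn)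
  refine fun a => exists_isLeviMeasure hv fun φ hφ => ?_
  refine ge_of_tendsto (tendsto_integral_mul_leviForm hv (fun n => (hw n).continuousOn) hwv φ a)
    (Eventually.of_forall fun n => ?_)
  rw [integral_mul_leviForm (hw n)]
  refine integral_nonneg_of_ae ?_
  filter_upwards [(ae_restrict_iff' Ω.isOpen.measurableSet).1 (hpos n a)] with p hp
  by_cases h : p ∈ Ω
  · exact mul_nonneg (hp h) (hφ p)
  · simp [eq_zero_of_tsupport_subset φ.tsupport_subset h]

theorem hasLeviMeasures_of_contDiffOn (hv : ContDiffOn ℝ 2 v Ω) (hpos : AELeviNonneg Ω v) :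
    HasLeviMeasures Ω v :=
  hasLeviMeasures_of_tendstoLocallyUniformlyOn (w := fun _ : ℕ => v) (l := atTop) (fun _ => hv)
    (fun _ => hpos) fun _ hu _ _ =>
      ⟨Ω, self_mem_nhdsWithin, Eventually.of_forall fun _ _ _ => refl_mem_uniformity hu⟩

end Convergence

theorem integral_withDensity_leviForm (hv : ContDiffOn ℝ 2 v Ω)
    (hpos : ∀ᵐ p ∂(volume.restrict (Ω : Set (ℂ × ℂ))), 0 ≤ leviForm v a p) {f : ℂ × ℂ → ℝ}
    (hfΩ : tsupport f ⊆ Ω) :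
    ∫ p, f p ∂((volume.restrict (Ω : Set (ℂ × ℂ))).withDensity
      fun p => ENNReal.ofReal (leviForm v a p)) = ∫ p, leviForm v a p * f p := by
  have hmeas := (continuousOn_leviForm hv a).aemeasurable (μ := volume) Ω.isOpen.measurableSet
  rw [integral_withDensity_eq_integral_toReal_smul₀ hmeas.ennreal_ofReal
      (ae_of_all _ fun _ => ENNReal.ofReal_lt_top),
    ← setIntegral_eq_integral_of_forall_compl_eq_zero (s := (Ω : Set (ℂ × ℂ)))
      (f := fun p => leviForm v a p * f p)
      fun p hp => by rw [eq_zero_of_tsupport_subset hfΩ hp, mul_zero]]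
  refine integral_congr_ae ?_
  filter_upwards [hpos] with p hp
  rw [ENNReal.toReal_ofReal hp, smul_eq_mul]

theorem isRadonOn_withDensity_leviForm (hv : ContDiffOn ℝ 2 v Ω) :
    IsRadonOn Ω ((volume.restrict (Ω : Set (ℂ × ℂ))).withDensity
      fun p => ENNReal.ofReal (leviForm v a p)) := by
  intro K hKΩ hK
  rw [withDensity_apply _ hK.measurableSet, Measure.restrict_restrict hK.measurableSet,
    inter_eq_left.2 hKΩ]
  exact (((continuousOn_leviForm hv a).mono hKΩ).integrableOn_compact hK).lintegral_lt_top

theorem integral_leviMeasure_of_contDiffOn (hv : ContDiffOn ℝ 2 v Ω) (hpos : AELeviNonneg Ω v)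
    {f : ℂ × ℂ → ℝ} (hf : CompactlySupportedIn Ω f) :
    ∫ p, f p ∂(leviMeasure Ω v a) = ∫ p, leviForm v a p * f p := by
  have hlv := hasLeviMeasures_of_contDiffOn hv hpos
  rw [← integral_withDensity_leviForm hv (hpos a) hf.tsupport_subset]
  refine integral_eq_of_forall_testFunction (isRadonOn_withDensity_leviForm hv)
    (isRadonOn_leviMeasure hlv a) (fun φ => ?_) hf
  rw [integral_leviMeasure hlv, integral_mul_leviForm hv,
    integral_withDensity_leviForm hv (hpos a) φ.tsupport_subset]

end LeviMeasure

/-! ### The Monge-Ampère functional -/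

section MongeAmpere

/-- Twice the mixed discriminant `h_{11} k_{22} + h_{22} k_{11} - 2 Re (h_{12} conj k_{12})` of two
Hermitian matrices, linearized: `D a b` stands for the product of the values at `a` and at `b` of
the quadratic forms of `h` and `k`. -/
noncomputable def mixedDiscr (D : ℂ × ℂ → ℂ × ℂ → ℝ) : ℝ :=
  coeff11 (fun a => coeff22 (D a)) + coeff22 (fun a => coeff11 (D a))
    - 2 * coeffRe12 (fun a => coeffRe12 (D a)) - 2 * coeffIm12 (fun a => coeffIm12 (D a))

theorem continuous_mixedDiscr : Continuous mixedDiscr := by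
  unfold mixedDiscr coeff11 coeff22 coeffRe12 coeffIm12
  fun_prop

theorem mixedDiscr_const_mul (c : ℝ) (D : ℂ × ℂ → ℂ × ℂ → ℝ) :
    mixedDiscr (fun a b => c * D a b) = c * mixedDiscr D := by
  simp only [mixedDiscr, coeff11, coeff22, coeffRe12, coeffIm12]
  ring

section Integral

variable {X : Type*} [MeasurableSpace X] {μ : Measure X}

theorem integral_coeffRe12 {F : ℂ × ℂ → X → ℝ} (hF : ∀ a, Integrable (F a) μ) :
    ∫ x, coeffRe12 (fun a => F a x) ∂μ = coeffRe12 fun a => ∫ x, F a x ∂μ := by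
  simp only [coeffRe12]
  rw [integral_div, integral_sub ((hF _).sub' (hF _)) (hF _), integral_sub (hF _) (hF _)]

theorem integral_coeffIm12 {F : ℂ × ℂ → X → ℝ} (hF : ∀ a, Integrable (F a) μ) :
    ∫ x, coeffIm12 (fun a => F a x) ∂μ = coeffIm12 fun a => ∫ x, F a x ∂μ := by
  simp only [coeffIm12]
  rw [integral_div, integral_sub ((hF _).sub' (hF _)) (hF _), integral_sub (hF _) (hF _)]

variable {D : ℂ × ℂ → ℂ × ℂ → X → ℝ}

theorem integrable_coeffRe12 {F : ℂ × ℂ → X → ℝ} (hF : ∀ a, Integrable (F a) μ) :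
    Integrable (fun x => coeffRe12 fun a => F a x) μ :=
  (((hF _).sub (hF _)).sub (hF _)).div_const 2

theorem integrable_coeffIm12 {F : ℂ × ℂ → X → ℝ} (hF : ∀ a, Integrable (F a) μ) :
    Integrable (fun x => coeffIm12 fun a => F a x) μ :=
  (((hF _).sub (hF _)).sub (hF _)).div_const 2

theorem integrable_mixedDiscr (hD : ∀ a b, Integrable (D a b) μ) :
    Integrable (fun x => mixedDiscr fun a b => D a b x) μ :=
  (((hD _ _).add (hD _ _)).sub
    ((integrable_coeffRe12 fun a => integrable_coeffRe12 (hD a)).const_mul 2)).sub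
    ((integrable_coeffIm12 fun a => integrable_coeffIm12 (hD a)).const_mul 2)

theorem integral_mixedDiscr (hD : ∀ a b, Integrable (D a b) μ) :
    ∫ x, mixedDiscr (fun a b => D a b x) ∂μ = mixedDiscr fun a b => ∫ x, D a b x ∂μ := by
  have hRe (a) := integrable_coeffRe12 (hD a)
  have hIm (a) := integrable_coeffIm12 (hD a)
  have hRe' := (integrable_coeffRe12 hRe).const_mul 2
  have hIm' := (integrable_coeffIm12 hIm).const_mul 2
  have hdiag := (hD (1, 0) (0, 1)).fun_add (hD (0, 1) (1, 0))
  simp only [mixedDiscr, coeff11, coeff22]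
  rw [integral_sub (hdiag.sub' hRe') hIm', integral_sub hdiag hRe', integral_const_mul,
    integral_const_mul, integral_add (hD _ _) (hD _ _), integral_coeffRe12 hRe,
    integral_coeffIm12 hIm]
  simp only [integral_coeffRe12 (hD _), integral_coeffIm12 (hD _)]

end Integral

variable {Ω : Opens (ℂ × ℂ)} {v : ℂ × ℂ → ℝ}

theorem mongeAmpere_eq_mixedDiscr (hv : ContinuousOn v Ω) (hlv : HasLeviMeasures Ω v)
    (φ : 𝓓(Ω, ℝ)) :
    mongeAmpere Ω v φ
      = 16 * mixedDiscr fun a b => ∫ p, v p * leviForm φ b p ∂(leviMeasure Ω v a) := by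
  have hint (a b) : Integrable (fun p => v p * leviForm φ b p) (leviMeasure Ω v a) :=
    (isRadonOn_leviMeasure hlv a).integrable ((compactlySupportedIn_leviForm φ b).mul_left hv)
  have hRe (p) : v p * coeffRe12 (fun b => leviForm φ b p)
      = coeffRe12 fun b => v p * leviForm φ b p := by simp only [coeffRe12]; ring
  have hIm (p) : v p * coeffIm12 (fun b => leviForm φ b p)
      = coeffIm12 fun b => v p * leviForm φ b p := by simp only [coeffIm12]; ring
  simp only [mongeAmpere, mixedDiscr, hRe, hIm, integral_coeffRe12 (hint _),
    integral_coeffIm12 (hint _)]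
  rfl

theorem tendsto_mongeAmpere {ι : Type*} {l : Filter ι} {w : ι → ℂ × ℂ → ℝ}
    (hv : ContinuousOn v Ω) (hw : ∀ n, ContinuousOn (w n) Ω)
    (hwv : TendstoLocallyUniformlyOn w v l Ω) (hlv : HasLeviMeasures Ω v)
    (hlw : ∀ n, HasLeviMeasures Ω (w n)) (φ : 𝓓(Ω, ℝ)) :
    Tendsto (fun n => mongeAmpere Ω (w n) φ) l (𝓝 (mongeAmpere Ω v φ)) := by
  simp only [mongeAmpere_eq_mixedDiscr (hw _) (hlw _), mongeAmpere_eq_mixedDiscr hv hlv]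
  refine ((continuous_mixedDiscr.tendsto _).comp ?_).const_mul 16
  exact tendsto_pi_nhds.2 fun a => tendsto_pi_nhds.2 fun b =>
    tendsto_integral_mul_leviMeasure hv hw hwv hlv hlw (compactlySupportedIn_leviForm φ b) a

theorem integrable_leviForm_mul_leviForm (hv : ContDiffOn ℝ 2 v Ω) (φ : 𝓓(Ω, ℝ)) (a b : ℂ × ℂ) :
    Integrable fun p => leviForm v a p * (v p * leviForm φ b p) :=
  ((compactlySupportedIn_leviForm φ b).mul_left hv.continuousOn).integrable_mul_left
    (continuousOn_leviForm hv a) volume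

/-- The density of `v dd^c φ ∧ dd^c v` with respect to Lebesgue measure, for `v` and `φ` of
class `C²`. -/
noncomputable def mongeAmpereDensity (v φ : ℂ × ℂ → ℝ) (p : ℂ × ℂ) : ℝ :=
  16 * mixedDiscr fun a b => leviForm v a p * (v p * leviForm φ b p)

theorem integrable_mongeAmpereDensity (hv : ContDiffOn ℝ 2 v Ω) (φ : 𝓓(Ω, ℝ)) :
    Integrable (mongeAmpereDensity v φ) :=
  (integrable_mixedDiscr (integrable_leviForm_mul_leviForm hv φ)).const_mul 16

theorem mongeAmpere_of_contDiffOn (hv : ContDiffOn ℝ 2 v Ω) (hpos : AELeviNonneg Ω v)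
    (φ : 𝓓(Ω, ℝ)) :
    mongeAmpere Ω v φ = ∫ p, mongeAmpereDensity v φ p := by
  have hvφ (b) := (compactlySupportedIn_leviForm φ b).mul_left hv.continuousOn
  rw [mongeAmpere_eq_mixedDiscr hv.continuousOn (hasLeviMeasures_of_contDiffOn hv hpos)]
  simp only [mongeAmpereDensity, integral_const_mul,
    integral_mixedDiscr (integrable_leviForm_mul_leviForm hv φ),
    integral_leviMeasure_of_contDiffOn hv hpos (hvφ _)]

theorem mongeAmpereDensity_congr {v' φ φ' : ℂ × ℂ → ℝ} {p : ℂ × ℂ} (hv : v =ᶠ[𝓝 p] v')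
    (hφ : φ =ᶠ[𝓝 p] φ') : mongeAmpereDensity v φ p = mongeAmpereDensity v' φ' p := by
  simp only [mongeAmpereDensity, leviForm_congr hv, leviForm_congr hφ, hv.eq_of_nhds]

end MongeAmpere

/-! ### The Levi form of composites and of logarithms -/

section Calculus

variable {f g : ℂ × ℂ → ℝ} {p : ℂ × ℂ}

/-- The real part of `∂_a f · conj (∂_a g)`, where `∂_a = ∑ a_j ∂/∂z_j`. -/
noncomputable def gradPair (f g : ℂ × ℂ → ℝ) (a p : ℂ × ℂ) : ℝ :=
  (fderiv ℝ f p a * fderiv ℝ g p a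
    + fderiv ℝ f p (Complex.I • a) * fderiv ℝ g p (Complex.I • a)) / 4

theorem gradPair_comm (f g : ℂ × ℂ → ℝ) (a p : ℂ × ℂ) : gradPair f g a p = gradPair g f a p := by
  simp only [gradPair]; ring

theorem gradPair_self_nonneg (f : ℂ × ℂ → ℝ) (a p : ℂ × ℂ) : 0 ≤ gradPair f f a p :=
  div_nonneg (add_nonneg (mul_self_nonneg _) (mul_self_nonneg _)) (by norm_num)

theorem gradPair_congr_left {f' : ℂ × ℂ → ℝ} (h : f =ᶠ[𝓝 p] f') (g : ℂ × ℂ → ℝ) (a : ℂ × ℂ) :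
    gradPair f g a p = gradPair f' g a p := by
  simp only [gradPair, h.fderiv_eq]

theorem gradPair_mul_left (hf : DifferentiableAt ℝ f p) (hg : DifferentiableAt ℝ g p)
    (k : ℂ × ℂ → ℝ) (a : ℂ × ℂ) :
    gradPair (fun q => f q * g q) k a p = f p * gradPair g k a p + g p * gradPair f k a p := by
  simp only [gradPair, fderiv_fun_mul hf hg, add_apply, smul_apply, smul_eq_mul]
  ring

theorem fderiv_comp_eq_deriv_smul {h : ℝ → ℝ} (hh : DifferentiableAt ℝ h (f p))
    (hf : DifferentiableAt ℝ f p) :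
    fderiv ℝ (fun q => h (f q)) p = deriv h (f p) • fderiv ℝ f p :=
  (hh.hasDerivAt.comp_hasFDerivAt p hf.hasFDerivAt).fderiv

theorem gradPair_comp_comp {h k : ℝ → ℝ} (hh : DifferentiableAt ℝ h (f p))
    (hf : DifferentiableAt ℝ f p) (hk : DifferentiableAt ℝ k (g p)) (hg : DifferentiableAt ℝ g p)
    (a : ℂ × ℂ) :
    gradPair (fun q => h (f q)) (fun q => k (g q)) a p
      = deriv h (f p) * deriv k (g p) * gradPair f g a p := by
  simp only [gradPair, fderiv_comp_eq_deriv_smul hh hf, fderiv_comp_eq_deriv_smul hk hg,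
    smul_apply, smul_eq_mul]
  ring

theorem leviForm_mul (hf : ContDiffAt ℝ 2 f p) (hg : ContDiffAt ℝ 2 g p) (a : ℂ × ℂ) :
    leviForm (fun q => f q * g q) a p
      = f p * leviForm g a p + g p * leviForm f a p + 2 * gradPair f g a p := by
  have hfg : fderiv ℝ (fun q => f q * g q) =ᶠ[𝓝 p]
      fun q => f q • fderiv ℝ g q + g q • fderiv ℝ f q := by
    filter_upwards [hf.eventually (by simp), hg.eventually (by simp)] with q hq hq'
    exact fderiv_fun_mul (hq.differentiableAt two_ne_zero) (hq'.differentiableAt two_ne_zero)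
  have hf' := differentiableAt_fderiv hf
  have hg' := differentiableAt_fderiv hg
  have hf1 : DifferentiableAt ℝ f p := hf.differentiableAt two_ne_zero
  have hg1 : DifferentiableAt ℝ g p := hg.differentiableAt two_ne_zero
  simp only [leviForm, gradPair, hfg.fderiv_eq]
  rw [fderiv_fun_add (hf1.fun_smul hg') (hg1.fun_smul hf'), fderiv_fun_smul hf1 hg',
    fderiv_fun_smul hg1 hf']
  simp only [add_apply, smul_apply, ContinuousLinearMap.smulRight_apply, smul_eq_mul]
  ring

theorem leviForm_comp {h : ℝ → ℝ} (hh : ContDiffAt ℝ 2 h (f p)) (hf : ContDiffAt ℝ 2 f p)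
    (a : ℂ × ℂ) :
    leviForm (fun q => h (f q)) a p
      = deriv h (f p) * leviForm f a p + deriv (deriv h) (f p) * gradPair f f a p := by
  have hhf : fderiv ℝ (fun q => h (f q)) =ᶠ[𝓝 p] fun q => deriv h (f q) • fderiv ℝ f q := by
    filter_upwards [hf.eventually (by simp),
      hf.continuousAt.eventually (hh.eventually (by simp))] with q hq hq'
    exact fderiv_comp_eq_deriv_smul (hq'.differentiableAt two_ne_zero)
      (hq.differentiableAt two_ne_zero)
  have hf1 : DifferentiableAt ℝ f p := hf.differentiableAt two_ne_zero
  have hh' : DifferentiableAt ℝ (deriv h) (f p) :=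
    (contDiffAt_fderiv_apply hh 1).differentiableAt one_ne_zero
  have hhf' : DifferentiableAt ℝ (fun q => deriv h (f q)) p := hh'.comp p hf1
  simp only [leviForm, gradPair, hhf.fderiv_eq]
  rw [fderiv_fun_smul hhf' (differentiableAt_fderiv hf), fderiv_comp_eq_deriv_smul hh' hf1]
  simp only [add_apply, smul_apply, ContinuousLinearMap.smulRight_apply, smul_eq_mul]
  ring

end Calculus

section LogNorm

theorem hasFDerivAt_log_norm {z : ℂ} (hz : z ≠ 0) :
    HasFDerivAt (fun ζ : ℂ => Real.log ‖ζ‖)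
      (Complex.reCLM ∘L (ContinuousLinearMap.toSpanSingleton ℂ z⁻¹).restrictScalars ℝ) z := by
  have hsq : HasFDerivAt (fun ζ : ℂ => ‖ζ‖ ^ 2) (2 • innerSL ℝ z) z :=
    (hasStrictFDerivAt_norm_sq z).hasFDerivAt
  refine (((hsq.log (by positivity)).const_mul (1 / 2 : ℝ)).congr_of_eventuallyEq
    (Eventually.of_forall fun ζ => ?_)).congr_fderiv ?_
  · simp [Real.log_pow]
  · ext b
    have hnorm : ‖z‖ ^ 2 = z.re * z.re + z.im * z.im := by
      rw [← Complex.normSq_eq_norm_sq, Complex.normSq_apply]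
    simp only [one_div, smul_apply, innerSL_apply_apply, Complex.inner, smul_eq_mul,
      ContinuousLinearMap.comp_apply, ContinuousLinearMap.coe_restrictScalars',
      ContinuousLinearMap.toSpanSingleton_apply, Complex.reCLM_apply, Complex.mul_re,
      Complex.inv_re, Complex.inv_im, Complex.conj_re, Complex.conj_im, Complex.normSq_apply,
      hnorm, nsmul_eq_mul, Nat.cast_ofNat]
    ring

variable {E : Type*} [NormedAddCommGroup E] [NormedSpace ℂ E] {ℓ : E →L[ℂ] ℂ} {p : E}

theorem contDiffAt_log_norm_clm {n : WithTop ℕ∞} (hp : ℓ p ≠ 0) :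
    ContDiffAt ℝ n (fun q => Real.log ‖ℓ q‖) p :=
  ((ℓ.restrictScalars ℝ).contDiff.contDiffAt.norm ℝ hp).log (norm_ne_zero_iff.2 hp)

theorem fderiv_log_norm_clm (hp : ℓ p ≠ 0) (a : E) :
    fderiv ℝ (fun q => Real.log ‖ℓ q‖) p a = (ℓ a / ℓ p).re := by
  have h : HasFDerivAt (fun q => Real.log ‖ℓ q‖) _ p :=
    (hasFDerivAt_log_norm hp).comp p (ℓ.restrictScalars ℝ).hasFDerivAt
  rw [h.fderiv]
  simp [div_eq_mul_inv]

theorem fderiv_fderiv_log_norm_clm (hp : ℓ p ≠ 0) (a : E) :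
    fderiv ℝ (fderiv ℝ fun q => Real.log ‖ℓ q‖) p a a = -((ℓ a / ℓ p) ^ 2).re := by
  have hfst : (fun q => fderiv ℝ (fun q => Real.log ‖ℓ q‖) q a) =ᶠ[𝓝 p]
      fun q => (ℓ a * (ℓ q)⁻¹).re := by
    filter_upwards [ℓ.continuous.continuousAt.eventually_ne hp] with q hq
    rw [fderiv_log_norm_clm hq, div_eq_mul_inv]
  have hinv : HasFDerivAt (fun q => (ℓ q)⁻¹) _ p :=
    ((hasDerivAt_inv hp).hasFDerivAt.restrictScalars ℝ).comp p
      (ℓ.restrictScalars ℝ).hasFDerivAt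
  have hre : HasFDerivAt (fun q => (ℓ a * (ℓ q)⁻¹).re) _ p :=
    Complex.reCLM.hasFDerivAt.comp p (hinv.const_mul (ℓ a))
  rw [← fderiv_fderiv_apply (contDiffAt_log_norm_clm hp), hfst.fderiv_eq, hre.fderiv,
    ← Complex.neg_re]
  simp only [ContinuousLinearMap.comp_apply, smul_apply, ContinuousLinearMap.coe_restrictScalars',
    ContinuousLinearMap.toSpanSingleton_apply, Complex.reCLM_apply, smul_eq_mul]
  congr 1
  field_simp

end LogNorm

section LeviLogNorm

variable {ℓ ℓ' : ℂ × ℂ →L[ℂ] ℂ} {p : ℂ × ℂ}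

theorem leviForm_log_norm_clm (hp : ℓ p ≠ 0) (a : ℂ × ℂ) :
    leviForm (fun q => Real.log ‖ℓ q‖) a p = 0 := by
  simp only [leviForm, fderiv_fderiv_log_norm_clm hp, map_smul, smul_eq_mul, mul_div_assoc,
    mul_pow, Complex.I_sq]
  simp

theorem gradPair_log_norm_clm (hp : ℓ p ≠ 0) (hp' : ℓ' p ≠ 0) (a : ℂ × ℂ) :
    gradPair (fun q => Real.log ‖ℓ q‖) (fun q => Real.log ‖ℓ' q‖) a p
      = inner ℝ (ℓ a / ℓ p) (ℓ' a / ℓ' p) / 4 := by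
  simp only [gradPair, fderiv_log_norm_clm hp, fderiv_log_norm_clm hp', map_smul, smul_eq_mul,
    mul_div_assoc, Complex.I_mul_re, Complex.inner, Complex.mul_re (_ : ℂ) (starRingEnd ℂ _),
    Complex.conj_re, Complex.conj_im]
  ring

end LeviLogNorm

/-! ### Functions of `-√(log |z| log |w|)` off the coordinate axes -/

section Blocki

/-- The punctured unit disc. -/
def puncturedDisc : Set ℂ := {z | z ≠ 0 ∧ ‖z‖ < 1}

theorem isOpen_puncturedDisc : IsOpen puncturedDisc :=
  (isOpen_ne_fun continuous_id continuous_const).inter (isOpen_lt continuous_norm continuous_const)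

theorem log_norm_neg {z : ℂ} (hz : z ∈ puncturedDisc) : Real.log ‖z‖ < 0 :=
  Real.log_neg (norm_pos_iff.2 hz.1) hz.2

/-- The bidisc without the coordinate axes, on which `u = -√(log |z| log |w|)` is smooth. -/
def toricBidisc : Set (ℂ × ℂ) := puncturedDisc ×ˢ puncturedDisc

theorem isOpen_toricBidisc : IsOpen toricBidisc := isOpen_puncturedDisc.prod isOpen_puncturedDisc

/-- The real-valued function `-√(log |z| log |w|)`. It agrees with `blockiFun` off the coordinate
axes only: on the axes it has the junk value `0`, because `Real.log 0 = 0`. -/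
noncomputable def blockiReal (p : ℂ × ℂ) : ℝ := -√(Real.log ‖p.1‖ * Real.log ‖p.2‖)

variable {p : ℂ × ℂ}

theorem log_mul_log_pos (hp : p ∈ toricBidisc) : 0 < Real.log ‖p.1‖ * Real.log ‖p.2‖ :=
  mul_pos_of_neg_of_neg (log_norm_neg hp.1) (log_norm_neg hp.2)

theorem blockiReal_neg (hp : p ∈ toricBidisc) : blockiReal p < 0 :=
  neg_lt_zero.2 (Real.sqrt_pos.2 (log_mul_log_pos hp))

theorem blockiReal_mul_self (hp : p ∈ toricBidisc) :
    blockiReal p * blockiReal p = Real.log ‖p.1‖ * Real.log ‖p.2‖ := by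
  rw [blockiReal, neg_mul_neg, Real.mul_self_sqrt (log_mul_log_pos hp).le]

theorem blockiReal_mul_self_eventuallyEq (hp : p ∈ toricBidisc) :
    (fun q => blockiReal q * blockiReal q) =ᶠ[𝓝 p]
      fun q => Real.log ‖q.1‖ * Real.log ‖q.2‖ := by
  filter_upwards [isOpen_toricBidisc.mem_nhds hp] with q hq
  exact blockiReal_mul_self hq

theorem contDiffAt_log_norm_fst {n : WithTop ℕ∞} (hp : p.1 ≠ 0) :
    ContDiffAt ℝ n (fun q : ℂ × ℂ => Real.log ‖q.1‖) p :=
  contDiffAt_log_norm_clm (ℓ := .fst ℂ ℂ ℂ) hp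

theorem contDiffAt_log_norm_snd {n : WithTop ℕ∞} (hp : p.2 ≠ 0) :
    ContDiffAt ℝ n (fun q : ℂ × ℂ => Real.log ‖q.2‖) p :=
  contDiffAt_log_norm_clm (ℓ := .snd ℂ ℂ ℂ) hp

theorem contDiffAt_blockiReal {n : WithTop ℕ∞} (hp : p ∈ toricBidisc) :
    ContDiffAt ℝ n blockiReal p :=
  (((contDiffAt_log_norm_fst hp.1.1).mul (contDiffAt_log_norm_snd hp.2.1)).sqrt
    (log_mul_log_pos hp).ne').neg

theorem leviForm_log_norm_fst (hp : p.1 ≠ 0) (a : ℂ × ℂ) :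
    leviForm (fun q : ℂ × ℂ => Real.log ‖q.1‖) a p = 0 :=
  leviForm_log_norm_clm (ℓ := .fst ℂ ℂ ℂ) hp a

theorem leviForm_log_norm_snd (hp : p.2 ≠ 0) (a : ℂ × ℂ) :
    leviForm (fun q : ℂ × ℂ => Real.log ‖q.2‖) a p = 0 :=
  leviForm_log_norm_clm (ℓ := .snd ℂ ℂ ℂ) hp a

theorem gradPair_log_norm_fst_fst (hp : p.1 ≠ 0) (a : ℂ × ℂ) :
    gradPair (fun q : ℂ × ℂ => Real.log ‖q.1‖) (fun q => Real.log ‖q.1‖) a p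
      = inner ℝ (a.1 / p.1) (a.1 / p.1) / 4 :=
  gradPair_log_norm_clm (ℓ := .fst ℂ ℂ ℂ) (ℓ' := .fst ℂ ℂ ℂ) hp hp a

theorem gradPair_log_norm_fst_snd (hp : p ∈ toricBidisc) (a : ℂ × ℂ) :
    gradPair (fun q : ℂ × ℂ => Real.log ‖q.1‖) (fun q => Real.log ‖q.2‖) a p
      = inner ℝ (a.1 / p.1) (a.2 / p.2) / 4 :=
  gradPair_log_norm_clm (ℓ := .fst ℂ ℂ ℂ) (ℓ' := .snd ℂ ℂ ℂ) hp.1.1 hp.2.1 a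

theorem gradPair_log_norm_snd_snd (hp : p.2 ≠ 0) (a : ℂ × ℂ) :
    gradPair (fun q : ℂ × ℂ => Real.log ‖q.2‖) (fun q => Real.log ‖q.2‖) a p
      = inner ℝ (a.2 / p.2) (a.2 / p.2) / 4 :=
  gradPair_log_norm_clm (ℓ := .snd ℂ ℂ ℂ) (ℓ' := .snd ℂ ℂ ℂ) hp hp a

-- The derivatives of `u` come from differentiating `u² = log |z| log |w|`.
theorem two_mul_blockiReal_mul_gradPair (hp : p ∈ toricBidisc) (k : ℂ × ℂ → ℝ) (a : ℂ × ℂ) :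
    2 * blockiReal p * gradPair blockiReal k a p
      = Real.log ‖p.1‖ * gradPair (fun q : ℂ × ℂ => Real.log ‖q.2‖) k a p
        + Real.log ‖p.2‖ * gradPair (fun q : ℂ × ℂ => Real.log ‖q.1‖) k a p := by
  have hu : DifferentiableAt ℝ blockiReal p :=
    (contDiffAt_blockiReal (n := 1) hp).differentiableAt one_ne_zero
  have h := gradPair_congr_left (blockiReal_mul_self_eventuallyEq hp) k a
  rw [gradPair_mul_left hu hu, gradPair_mul_left
    ((contDiffAt_log_norm_fst (n := 1) hp.1.1).differentiableAt one_ne_zero)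
    ((contDiffAt_log_norm_snd (n := 1) hp.2.1).differentiableAt one_ne_zero)] at h
  linarith

theorem gradPair_log_norm_fst_blockiReal (hp : p ∈ toricBidisc) (a : ℂ × ℂ) :
    gradPair (fun q : ℂ × ℂ => Real.log ‖q.1‖) blockiReal a p
      = (Real.log ‖p.2‖ * inner ℝ (a.1 / p.1) (a.1 / p.1)
        + Real.log ‖p.1‖ * inner ℝ (a.1 / p.1) (a.2 / p.2)) / (8 * blockiReal p) := by
  have h := two_mul_blockiReal_mul_gradPair hp (fun q : ℂ × ℂ => Real.log ‖q.1‖) a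
  rw [gradPair_comm (fun q : ℂ × ℂ => Real.log ‖q.2‖), gradPair_log_norm_fst_snd hp,
    gradPair_log_norm_fst_fst hp.1.1] at h
  rw [gradPair_comm, eq_div_iff (by simpa using (blockiReal_neg hp).ne)]
  linarith

theorem gradPair_log_norm_snd_blockiReal (hp : p ∈ toricBidisc) (a : ℂ × ℂ) :
    gradPair (fun q : ℂ × ℂ => Real.log ‖q.2‖) blockiReal a p
      = (Real.log ‖p.1‖ * inner ℝ (a.2 / p.2) (a.2 / p.2)
        + Real.log ‖p.2‖ * inner ℝ (a.1 / p.1) (a.2 / p.2)) / (8 * blockiReal p) := by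
  have h := two_mul_blockiReal_mul_gradPair hp (fun q : ℂ × ℂ => Real.log ‖q.2‖) a
  rw [gradPair_log_norm_fst_snd hp, gradPair_log_norm_snd_snd hp.2.1] at h
  rw [gradPair_comm, eq_div_iff (by simpa using (blockiReal_neg hp).ne)]
  linarith

/-- The Hermitian form whose matrix in logarithmic coordinates at `p` has the entries `P / 4`,
`R / 4`, `S / 4`. If `P`, `R`, `S` are the second derivatives of a function `f (x, y)`, this is the
Levi form at `p` of `f (log |z|, log |w|)`. -/
noncomputable def logForm (p : ℂ × ℂ) (P R S : ℝ) (a : ℂ × ℂ) : ℝ :=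
  (P * inner ℝ (a.1 / p.1) (a.1 / p.1) + 2 * R * inner ℝ (a.1 / p.1) (a.2 / p.2)
    + S * inner ℝ (a.2 / p.2) (a.2 / p.2)) / 4

theorem mixedDiscr_logForm (p : ℂ × ℂ) (P R S P' R' S' : ℝ) :
    mixedDiscr (fun a b => logForm p P R S a * logForm p P' R' S' b)
      = (P * S' + S * P' - 2 * R * R') / (16 * (‖p.1‖ ^ 2 * ‖p.2‖ ^ 2)) := by
  have hinv (z : ℂ) : (‖z‖ ^ 2)⁻¹ = inner ℝ (1 / z) (1 / z) := by
    rw [real_inner_self_eq_norm_sq, norm_div, norm_one, one_div, inv_pow]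
  rw [div_eq_mul_inv, mul_inv, mul_inv, hinv, hinv]
  simp only [mixedDiscr, logForm, coeff11, coeff22, coeffRe12, coeffIm12, zero_div,
    ← mul_one_div Complex.I p.2]
  generalize 1 / p.1 = A
  generalize 1 / p.2 = B
  simp only [Complex.inner, Complex.mul_re, Complex.mul_im, Complex.I_re, Complex.I_im,
    Complex.conj_re, Complex.conj_im, Complex.zero_re, Complex.zero_im]
  ring

theorem gradPair_blockiReal (hp : p ∈ toricBidisc) (a : ℂ × ℂ) :
    gradPair blockiReal blockiReal a p
      = logForm p (Real.log ‖p.2‖ ^ 2) (Real.log ‖p.1‖ * Real.log ‖p.2‖) (Real.log ‖p.1‖ ^ 2) a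
        / (4 * blockiReal p ^ 2) := by
  have ht := (blockiReal_neg hp).ne
  have h := two_mul_blockiReal_mul_gradPair hp blockiReal a
  rw [gradPair_log_norm_fst_blockiReal hp, gradPair_log_norm_snd_blockiReal hp] at h
  rw [logForm]
  field_simp at h ⊢
  linarith

theorem leviForm_blockiReal (hp : p ∈ toricBidisc) (a : ℂ × ℂ) :
    leviForm blockiReal a p
      = logForm p (Real.log ‖p.2‖ ^ 2) (-(Real.log ‖p.1‖ * Real.log ‖p.2‖)) (Real.log ‖p.1‖ ^ 2) a
        / (4 * -blockiReal p ^ 3) := by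
  have ht := (blockiReal_neg hp).ne
  have hsq := blockiReal_mul_self hp
  have h := leviForm_congr (blockiReal_mul_self_eventuallyEq hp) a
  rw [leviForm_mul (contDiffAt_blockiReal hp) (contDiffAt_blockiReal hp),
    leviForm_mul (contDiffAt_log_norm_fst hp.1.1) (contDiffAt_log_norm_snd hp.2.1),
    leviForm_log_norm_fst hp.1.1, leviForm_log_norm_snd hp.2.1,
    gradPair_log_norm_fst_snd hp, gradPair_blockiReal hp] at h
  rw [eq_div_iff (by simpa using ht)]
  simp only [logForm] at h ⊢
  generalize leviForm blockiReal a p = L at *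
  generalize blockiReal p = t at *
  field_simp at h
  linear_combination (-1 / 8) * h - inner ℝ (a.1 / p.1) (a.2 / p.2) * hsq

theorem logForm_nonneg_of_perfect_square (p : ℂ × ℂ) (x y : ℝ) (a : ℂ × ℂ) :
    0 ≤ logForm p (y ^ 2) (-(x * y)) (x ^ 2) a := by
  have hsq : logForm p (y ^ 2) (-(x * y)) (x ^ 2) a
      = ‖y • (a.1 / p.1) - x • (a.2 / p.2)‖ ^ 2 / 4 := by
    rw [norm_sub_sq_real, norm_smul, norm_smul, mul_pow, mul_pow, Real.norm_eq_abs,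
      Real.norm_eq_abs, sq_abs, sq_abs, ← real_inner_self_eq_norm_sq, ← real_inner_self_eq_norm_sq,
      real_inner_smul_left, real_inner_smul_right, logForm]
    ring
  rw [hsq]
  positivity

theorem leviForm_comp_blockiReal_nonneg (hp : p ∈ toricBidisc) {g : ℝ → ℝ}
    (hg : ContDiffAt ℝ 2 g (blockiReal p)) (hg' : 0 ≤ deriv g (blockiReal p))
    (hg'' : 0 ≤ deriv (deriv g) (blockiReal p)) (a : ℂ × ℂ) :
    0 ≤ leviForm (fun q => g (blockiReal q)) a p := by
  have hcube : 0 < -blockiReal p ^ 3 := neg_pos.2 (Odd.pow_neg (by decide) (blockiReal_neg hp))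
  rw [leviForm_comp hg (contDiffAt_blockiReal hp), leviForm_blockiReal hp]
  have := logForm_nonneg_of_perfect_square p (Real.log ‖p.1‖) (Real.log ‖p.2‖) a
  have := gradPair_self_nonneg blockiReal a p
  positivity

/-- The second derivatives of `g (-√(x y))` at a point where `-√(x y) = t` are
`y ^ 2 * hessDiag g t`, `x * y * hessOffDiag g t` and `x ^ 2 * hessDiag g t`. -/
noncomputable def hessDiag (g : ℝ → ℝ) (t : ℝ) : ℝ :=
  deriv (deriv g) t / (4 * t ^ 2) - deriv g t / (4 * t ^ 3)

/-- The factor of the mixed second derivative of `g (-√(x y))`, see `hessDiag`. -/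
noncomputable def hessOffDiag (g : ℝ → ℝ) (t : ℝ) : ℝ :=
  deriv (deriv g) t / (4 * t ^ 2) + deriv g t / (4 * t ^ 3)

theorem leviForm_comp_blockiReal (hp : p ∈ toricBidisc) {g : ℝ → ℝ}
    (hg : ContDiffAt ℝ 2 g (blockiReal p)) (a : ℂ × ℂ) :
    leviForm (fun q => g (blockiReal q)) a p
      = logForm p (Real.log ‖p.2‖ ^ 2 * hessDiag g (blockiReal p))
          (Real.log ‖p.1‖ * Real.log ‖p.2‖ * hessOffDiag g (blockiReal p))
          (Real.log ‖p.1‖ ^ 2 * hessDiag g (blockiReal p)) a := by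
  have ht := (blockiReal_neg hp).ne
  rw [leviForm_comp hg (contDiffAt_blockiReal hp), leviForm_blockiReal hp, gradPair_blockiReal hp]
  simp only [logForm, hessDiag, hessOffDiag]
  field_simp
  ring

theorem leviForm_comp_log_norm_fst (hp : p.1 ≠ 0) {α : ℝ → ℝ}
    (hα : ContDiffAt ℝ 2 α (Real.log ‖p.1‖)) (a : ℂ × ℂ) :
    leviForm (fun q : ℂ × ℂ => α (Real.log ‖q.1‖)) a p
      = logForm p (deriv (deriv α) (Real.log ‖p.1‖)) 0 0 a := by
  rw [leviForm_comp hα (contDiffAt_log_norm_fst hp),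
    leviForm_log_norm_fst hp, gradPair_log_norm_fst_fst hp, logForm]
  ring

theorem leviForm_mul_comp_blockiReal (hp : p ∈ toricBidisc) {α B : ℝ → ℝ}
    (hα : ContDiffAt ℝ 2 α (Real.log ‖p.1‖)) (hB : ContDiffAt ℝ 2 B (blockiReal p))
    (a : ℂ × ℂ) :
    leviForm (fun q => α (Real.log ‖q.1‖) * B (blockiReal q)) a p
      = logForm p
        (α (Real.log ‖p.1‖) * (Real.log ‖p.2‖ ^ 2 * hessDiag B (blockiReal p))
          + B (blockiReal p) * deriv (deriv α) (Real.log ‖p.1‖)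
          + deriv α (Real.log ‖p.1‖) * deriv B (blockiReal p) * Real.log ‖p.2‖ / blockiReal p)
        (α (Real.log ‖p.1‖) * (Real.log ‖p.1‖ * Real.log ‖p.2‖ * hessOffDiag B (blockiReal p))
          + deriv α (Real.log ‖p.1‖) * deriv B (blockiReal p) * Real.log ‖p.1‖
            / (2 * blockiReal p))
        (α (Real.log ‖p.1‖) * (Real.log ‖p.1‖ ^ 2 * hessDiag B (blockiReal p))) a := by
  have ht := (blockiReal_neg hp).ne
  have hX : ContDiffAt ℝ 2 (fun q : ℂ × ℂ => Real.log ‖q.1‖) p := contDiffAt_log_norm_fst hp.1.1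
  have hT : ContDiffAt ℝ 2 blockiReal p := contDiffAt_blockiReal hp
  rw [leviForm_mul (f := fun q : ℂ × ℂ => α (Real.log ‖q.1‖)) (g := fun q => B (blockiReal q))
      (hα.comp p hX) (hB.comp p hT),
    leviForm_comp_blockiReal hp hB, leviForm_comp_log_norm_fst hp.1.1 hα,
    gradPair_comp_comp (f := fun q : ℂ × ℂ => Real.log ‖q.1‖) (hα.differentiableAt two_ne_zero)
      (hX.differentiableAt two_ne_zero) (hB.differentiableAt two_ne_zero)
      (hT.differentiableAt two_ne_zero),
    gradPair_log_norm_fst_blockiReal hp]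
  simp only [logForm]
  field_simp
  ring

/-- The density of `v dd^c φ ∧ dd^c v` for `v = g (u)` and `φ = α (log |z|) B (u)`, in the
coordinates `x = log |z|` and `t = u = -√(log |z| log |w|)` and up to the factor `|z w|⁻²`. -/
noncomputable def toricDensity (g α B : ℝ → ℝ) (x t : ℝ) : ℝ :=
  g t * (-(α x) * (deriv (deriv g) t * deriv B t + deriv g t * deriv (deriv B) t) / (4 * t)
    + x ^ 2 * B t * deriv (deriv α) x * hessDiag g t
    - x * deriv α x * deriv B t * deriv g t / (2 * t ^ 2))

theorem mongeAmpereDensity_comp_blockiReal (hp : p ∈ toricBidisc) {g α B : ℝ → ℝ}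
    (hg : ContDiffAt ℝ 2 g (blockiReal p)) (hα : ContDiffAt ℝ 2 α (Real.log ‖p.1‖))
    (hB : ContDiffAt ℝ 2 B (blockiReal p)) :
    mongeAmpereDensity (fun q => g (blockiReal q))
        (fun q => α (Real.log ‖q.1‖) * B (blockiReal q)) p
      = toricDensity g α B (Real.log ‖p.1‖) (blockiReal p) / (‖p.1‖ ^ 2 * ‖p.2‖ ^ 2) := by
  have ht := (blockiReal_neg hp).ne
  have hx := (log_norm_neg hp.1).ne
  have hy : Real.log ‖p.2‖ = blockiReal p ^ 2 / Real.log ‖p.1‖ := by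
    rw [eq_div_iff hx, pow_two, blockiReal_mul_self hp, mul_comm]
  have hz : ‖p.1‖ ≠ 0 := norm_ne_zero_iff.2 hp.1.1
  have hw : ‖p.2‖ ≠ 0 := norm_ne_zero_iff.2 hp.2.1
  simp only [mongeAmpereDensity, mul_left_comm _ (g _), mixedDiscr_const_mul,
    leviForm_comp_blockiReal hp hg, leviForm_mul_comp_blockiReal hp hα hB, mixedDiscr_logForm]
  rw [hy]
  simp only [toricDensity, hessDiag, hessOffDiag]
  field_simp
  ring

end Blocki

/-! ### Extension across the coordinate axes -/

section ToricExt

/-- The union of the two coordinate axes of `ℂ²`. -/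
def coordAxes : Set (ℂ × ℂ) := {p | p.1 = 0 ∨ p.2 = 0}

open Classical in
/-- The function `g (-√(log |z| log |w|))`, with the value `c` on the coordinate axes. -/
noncomputable def toricExt (g : ℝ → ℝ) (c : ℝ) (p : ℂ × ℂ) : ℝ :=
  if p ∈ coordAxes then c else g (blockiReal p)

variable {p : ℂ × ℂ} {g : ℝ → ℝ} {c : ℝ}

theorem toricExt_of_mem (hp : p ∈ coordAxes) (g : ℝ → ℝ) (c : ℝ) : toricExt g c p = c := if_pos hp

theorem toricExt_of_notMem (hp : p ∉ coordAxes) (g : ℝ → ℝ) (c : ℝ) :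
    toricExt g c p = g (blockiReal p) := if_neg hp

theorem extendBot_blockiFun (χ : ℝ → ℝ) :
    (fun p => extendBot χ (blockiFun p)) = toricExt χ (sInf (χ '' Iio 0)) := by
  funext p
  by_cases hp : p.1 = 0 ∨ p.2 = 0
  · rw [toricExt_of_mem hp, blockiFun, if_pos hp, extendBot, if_pos rfl]
  · rw [toricExt_of_notMem hp, blockiFun, if_neg hp, extendBot, if_neg (EReal.coe_ne_bot _),
      EReal.toReal_coe, blockiReal]

theorem mem_puncturedBidisc : p ∈ puncturedBidisc ↔ (‖p.1‖ < 1 ∧ ‖p.2‖ < 1) ∧ p ≠ 0 := by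
  change (p.1 ∈ Metric.ball (0 : ℂ) 1 ∧ p.2 ∈ Metric.ball (0 : ℂ) 1) ∧ p ≠ 0 ↔ _
  rw [mem_ball_zero_iff, mem_ball_zero_iff]

theorem notMem_coordAxes_of_mem_toricBidisc (hp : p ∈ toricBidisc) : p ∉ coordAxes :=
  not_or.2 ⟨hp.1.1, hp.2.1⟩

theorem toricBidisc_subset_puncturedBidisc : toricBidisc ⊆ puncturedBidisc := fun _ hp =>
  mem_puncturedBidisc.2 ⟨⟨hp.1.2, hp.2.2⟩, fun h => hp.1.1 (congrArg Prod.fst h)⟩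

theorem mem_toricBidisc_of_notMem_coordAxes (hp : p ∈ puncturedBidisc) (hp' : p ∉ coordAxes) :
    p ∈ toricBidisc :=
  have ⟨h, _⟩ := mem_puncturedBidisc.1 hp
  ⟨⟨(not_or.1 hp').1, h.1⟩, ⟨(not_or.1 hp').2, h.2⟩⟩

theorem toricExt_eventuallyEq (hp : p ∈ toricBidisc) (g : ℝ → ℝ) (c : ℝ) :
    toricExt g c =ᶠ[𝓝 p] fun q => g (blockiReal q) := by
  filter_upwards [isOpen_toricBidisc.mem_nhds hp] with q hq
  exact toricExt_of_notMem (notMem_coordAxes_of_mem_toricBidisc hq) g c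

theorem tendsto_neg_sqrt_mul_atBot {ι : Type*} {l : Filter ι} {x y : ι → ℝ} {b : ℝ}
    (hx : Tendsto x l atBot) (hb : b < 0) (hy : Tendsto y l (𝓝 b)) :
    Tendsto (fun i => -√(x i * y i)) l atBot :=
  tendsto_neg_atTop_atBot.comp (Real.tendsto_sqrt_atTop.comp (hx.atBot_mul_neg hb hy))

theorem tendsto_log_norm_nhdsNE_zero : Tendsto (fun z : ℂ => Real.log ‖z‖) (𝓝[≠] 0) atBot :=
  Real.tendsto_log_nhdsGT_zero.comp tendsto_norm_nhdsNE_zero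

theorem tendsto_log_norm {ι : Type*} {l : Filter ι} {f : ι → ℂ} {z : ℂ} (hz : z ≠ 0)
    (hf : Tendsto f l (𝓝 z)) : Tendsto (fun i => Real.log ‖f i‖) l (𝓝 (Real.log ‖z‖)) :=
  hf.norm.log (norm_ne_zero_iff.2 hz)

-- The origin has to be excluded: there, one logarithm could tend to `0` while the other diverges.
theorem tendsto_blockiReal_atBot (hp : p ∈ puncturedBidisc) (hp' : p ∈ coordAxes) :
    Tendsto blockiReal (𝓝[coordAxesᶜ] p) atBot := by
  obtain ⟨⟨hz1, hw1⟩, h0⟩ := mem_puncturedBidisc.1 hp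
  have hfst : Tendsto Prod.fst (𝓝[coordAxesᶜ] p) (𝓝 p.1) :=
    continuousAt_fst.mono_left nhdsWithin_le_nhds
  have hsnd : Tendsto Prod.snd (𝓝[coordAxesᶜ] p) (𝓝 p.2) :=
    continuousAt_snd.mono_left nhdsWithin_le_nhds
  have hne : ∀ᶠ q in 𝓝[coordAxesᶜ] p, q.1 ≠ 0 ∧ q.2 ≠ 0 :=
    eventually_mem_nhdsWithin.mono fun q hq => not_or.1 hq
  rcases hp' with hz | hw
  · have hw : p.2 ≠ 0 := fun hw => h0 (Prod.ext hz hw)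
    refine tendsto_neg_sqrt_mul_atBot (tendsto_log_norm_nhdsNE_zero.comp ?_)
      (log_norm_neg ⟨hw, hw1⟩) (tendsto_log_norm hw hsnd)
    exact tendsto_nhdsWithin_iff.2 ⟨hz ▸ hfst, hne.mono fun q hq => hq.1⟩
  · have hz : p.1 ≠ 0 := fun hz => h0 (Prod.ext hz hw)
    have hsymm : blockiReal = fun q => -√(Real.log ‖q.2‖ * Real.log ‖q.1‖) := by
      funext q; rw [blockiReal, mul_comm]
    rw [hsymm]
    refine tendsto_neg_sqrt_mul_atBot (tendsto_log_norm_nhdsNE_zero.comp ?_)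
      (log_norm_neg ⟨hz, hz1⟩) (tendsto_log_norm hz hfst)
    exact tendsto_nhdsWithin_iff.2 ⟨hw ▸ hsnd, hne.mono fun q hq => hq.2⟩

theorem contDiffOn_toricExt {n : WithTop ℕ∞} (hg : ContDiff ℝ n g)
    (hc : ∀ᶠ t in atBot, g t = c) : ContDiffOn ℝ n (toricExt g c) puncturedBidisc := by
  refine fun p hp => ContDiffAt.contDiffWithinAt ?_
  by_cases hp' : p ∈ coordAxes
  · have hconst : toricExt g c =ᶠ[𝓝 p] fun _ => c := by
      filter_upwards [eventually_nhdsWithin_iff.1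
        ((tendsto_blockiReal_atBot hp hp').eventually hc)] with q hq
      by_cases hq' : q ∈ coordAxes
      · exact toricExt_of_mem hq' g c
      · rw [toricExt_of_notMem hq', hq hq']
    exact contDiffAt_const.congr_of_eventuallyEq hconst
  · have hp'' := mem_toricBidisc_of_notMem_coordAxes hp hp'
    exact (hg.contDiffAt.comp p (contDiffAt_blockiReal hp'')).congr_of_eventuallyEq
      (toricExt_eventuallyEq hp'' g c)

theorem exists_neg_eventually_blockiReal_le (hp : p ∈ puncturedBidisc) :
    ∃ b < 0, ∀ᶠ q in 𝓝 p, q ∉ coordAxes → blockiReal q ≤ b := by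
  by_cases hp' : p ∈ coordAxes
  · exact ⟨-1, by norm_num, eventually_nhdsWithin_iff.1
      ((tendsto_blockiReal_atBot hp hp').eventually (eventually_le_atBot _))⟩
  · have hp'' := mem_toricBidisc_of_notMem_coordAxes hp hp'
    have hneg := blockiReal_neg hp''
    refine ⟨blockiReal p / 2, by linarith, ?_⟩
    filter_upwards [(contDiffAt_blockiReal (n := 0) hp'').continuousAt.eventually
      (eventually_le_nhds (show blockiReal p < blockiReal p / 2 by linarith))] with q hq _ using hq

theorem ae_notMem_coordAxes : ∀ᵐ p, p ∉ coordAxes := by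
  have hne : ∀ᵐ z : ℂ, z ≠ 0 := by
    simp only [ae_iff, not_not, ofPred_eq_eq_singleton, measure_singleton]
  filter_upwards [Measure.quasiMeasurePreserving_fst.ae hne,
    Measure.quasiMeasurePreserving_snd.ae hne] with p hfst hsnd using not_or.2 ⟨hfst, hsnd⟩

end ToricExt

section SmoothWeight

/-- The smooth functions `g` for which `toricExt g c` is smooth and plurisubharmonic on the
punctured bidisc. -/
structure IsSmoothWeight (g : ℝ → ℝ) (c : ℝ) : Prop where
  contDiff : ContDiff ℝ ∞ g
  eventually_eq : ∀ᶠ t in atBot, g t = c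
  monotoneOn : MonotoneOn g (Iio 0)
  convexOn : ConvexOn ℝ (Iio 0) g

namespace IsSmoothWeight

variable {g : ℝ → ℝ} {c : ℝ}

theorem contDiff_two (hg : IsSmoothWeight g c) : ContDiff ℝ 2 g :=
  hg.contDiff.of_le (WithTop.coe_le_coe.2 le_top)

theorem deriv_nonneg (hg : IsSmoothWeight g c) {t : ℝ} (ht : t < 0) : 0 ≤ deriv g t := by
  rw [← derivWithin_of_isOpen isOpen_Iio ht]
  exact hg.monotoneOn.derivWithin_nonneg

theorem deriv_deriv_nonneg (hg : IsSmoothWeight g c) {t : ℝ} (ht : t < 0) :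
    0 ≤ deriv (deriv g) t := by
  rw [← derivWithin_of_isOpen isOpen_Iio ht]
  exact (hg.convexOn.monotoneOn_deriv fun s _ =>
    (hg.contDiff_two.differentiable two_ne_zero).differentiableAt).derivWithin_nonneg

theorem contDiffOn_toricExt (hg : IsSmoothWeight g c) :
    ContDiffOn ℝ 2 (toricExt g c) puncturedBidisc :=
  _root_.contDiffOn_toricExt hg.contDiff_two hg.eventually_eq

theorem aeLeviNonneg_toricExt (hg : IsSmoothWeight g c) :
    AELeviNonneg puncturedBidisc (toricExt g c) := by
  intro a
  rw [ae_restrict_iff' puncturedBidisc.isOpen.measurableSet]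
  filter_upwards [ae_notMem_coordAxes] with p hp hpΩ
  have hp' := mem_toricBidisc_of_notMem_coordAxes hpΩ hp
  rw [leviForm_congr (toricExt_eventuallyEq hp' g c)]
  exact leviForm_comp_blockiReal_nonneg hp' hg.contDiff_two.contDiffAt
    (hg.deriv_nonneg (blockiReal_neg hp')) (hg.deriv_deriv_nonneg (blockiReal_neg hp')) a

end IsSmoothWeight

end SmoothWeight

/-! ### Toric test functions -/

section ToricCutoff

theorem exists_neg_tsupport_subset_Iic {f : ℝ → ℝ} (hf : tsupport f ⊆ Iio 0) :
    ∃ s < 0, tsupport f ⊆ Iic s := by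
  have h0 : (tsupport f)ᶜ ∈ 𝓝 0 :=
    (isClosed_tsupport f).isOpen_compl.mem_nhds fun h => lt_irrefl (0 : ℝ) (hf h)
  obtain ⟨s, hs, hsub⟩ := exists_Ioc_subset_of_mem_nhds h0 (exists_lt 0)
  exact ⟨s, hs, fun t ht => not_lt.1 fun hst => hsub ⟨hst, (hf ht).le⟩ ht⟩

/-- The data of a test function `radial (log |z|) * profile (u)` on the punctured bidisc: it
localizes away from the axis `z = 0`, but equals `radial (log |z|)` near the axis `w = 0`, where
`u = -∞`. -/
structure ToricCutoff where
  radial : ℝ → ℝ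
  profile : ℝ → ℝ
  contDiff_radial : ContDiff ℝ ∞ radial
  hasCompactSupport_radial : HasCompactSupport radial
  tsupport_radial_subset : tsupport radial ⊆ Iio 0
  radial_nonneg : ∀ x, 0 ≤ radial x
  exists_radial_ne_zero : ∃ x, radial x ≠ 0
  contDiff_profile : ContDiff ℝ ∞ profile
  tsupport_profile_subset : tsupport profile ⊆ Iio 0
  eventually_profile_eq_one : ∀ᶠ t in atBot, profile t = 1
  antitone_profile : Antitone profile

theorem nonempty_toricCutoff : Nonempty ToricCutoff := by
  let radial : ContDiffBump (-2 : ℝ) := ⟨1 / 2, 1, by norm_num, by norm_num⟩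
  refine ⟨{
    radial := radial
    profile := fun t => Real.smoothTransition (-1 - t)
    contDiff_radial := radial.contDiff
    hasCompactSupport_radial := radial.hasCompactSupport
    tsupport_radial_subset := fun x hx => ?_
    radial_nonneg := fun _ => radial.nonneg
    exists_radial_ne_zero :=
      ⟨-2, (radial.pos_of_mem_ball (Metric.mem_ball_self radial.rOut_pos)).ne'⟩
    contDiff_profile := Real.smoothTransition.contDiff.comp (contDiff_const.sub contDiff_id)
    tsupport_profile_subset := ?_
    eventually_profile_eq_one := ?_
    antitone_profile := fun s t hst => Real.smoothTransition.monotone (by linarith) }⟩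
  · rw [radial.tsupport_eq, Metric.mem_closedBall, Real.dist_eq, abs_le] at hx
    exact mem_Iio.2 (by linarith [hx.2])
  · refine (closure_minimal (fun t ht => ?_) isClosed_Iic).trans (Iic_subset_Iio.2 neg_one_lt_zero)
    exact not_lt.1 fun (h : -1 < t) => ht (Real.smoothTransition.zero_of_nonpos (by linarith))
  · filter_upwards [eventually_le_atBot (-2)] with t ht
    exact Real.smoothTransition.one_of_one_le (by linarith)

/-- The product of the annulus `r ≤ log |z| ≤ s` and the disc `log |w| ≤ σ`. -/
def logBox (r s σ : ℝ) : Set (ℂ × ℂ) :=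
  (Metric.closedBall 0 (Real.exp s) ∩ {z | Real.exp r ≤ ‖z‖}) ×ˢ Metric.closedBall 0 (Real.exp σ)

theorem isCompact_logBox (r s σ : ℝ) : IsCompact (logBox r s σ) :=
  ((isCompact_closedBall _ _).inter_right (isClosed_le continuous_const continuous_norm)).prod
    (isCompact_closedBall _ _)

theorem fst_ne_zero_of_mem_logBox {r s σ : ℝ} {p : ℂ × ℂ} (hp : p ∈ logBox r s σ) : p.1 ≠ 0 :=
  norm_pos_iff.1 ((Real.exp_pos r).trans_le hp.1.2)

theorem logBox_subset_puncturedBidisc (r : ℝ) {s σ : ℝ} (hs : s < 0) (hσ : σ < 0) :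
    logBox r s σ ⊆ puncturedBidisc := fun _ hp =>
  mem_puncturedBidisc.2 ⟨⟨(mem_closedBall_zero_iff.1 hp.1.1).trans_lt (Real.exp_lt_one_iff.2 hs),
    (mem_closedBall_zero_iff.1 hp.2).trans_lt (Real.exp_lt_one_iff.2 hσ)⟩,
    fun h => fst_ne_zero_of_mem_logBox hp (congrArg Prod.fst h)⟩

namespace ToricCutoff

variable (θ : ToricCutoff)

/-- The function `radial (log |z|) * profile (u)`. -/
noncomputable def toFun (p : ℂ × ℂ) : ℝ := θ.radial (Real.log ‖p.1‖) * toricExt θ.profile 1 p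

theorem exists_tsupport_toFun_subset_logBox :
    ∃ r s σ, s < 0 ∧ σ < 0 ∧ tsupport θ.toFun ⊆ logBox r s σ := by
  obtain ⟨s, hs, hradial⟩ := exists_neg_tsupport_subset_Iic θ.tsupport_radial_subset
  obtain ⟨τ, hτ, hprofile⟩ := exists_neg_tsupport_subset_Iic θ.tsupport_profile_subset
  obtain ⟨r, hr⟩ := θ.hasCompactSupport_radial.isCompact.bddBelow
  obtain ⟨x₀, hx₀⟩ := θ.exists_radial_ne_zero
  have hr0 : r < 0 := (hr (subset_tsupport _ hx₀)).trans_lt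
    (θ.tsupport_radial_subset (subset_tsupport _ hx₀))
  refine ⟨r, s, τ ^ 2 / r, hs, div_neg_of_pos_of_neg (sq_pos_of_neg hτ) hr0,
    closure_minimal (fun p hp => ?_) (isCompact_logBox r s _).isClosed⟩
  have hx := subset_tsupport _ (left_ne_zero_of_mul hp)
  have hrx : r ≤ Real.log ‖p.1‖ := hr hx
  have hxs : Real.log ‖p.1‖ ≤ s := hradial hx
  have hz : p.1 ≠ 0 := fun h => by
    rw [h, norm_zero, Real.log_zero] at hxs
    exact hxs.not_gt hs
  refine ⟨⟨mem_closedBall_zero_iff.2 ((Real.log_le_iff_le_exp (norm_pos_iff.2 hz)).1 hxs),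
    (Real.le_log_iff_exp_le (norm_pos_iff.2 hz)).1 hrx⟩, mem_closedBall_zero_iff.2 ?_⟩
  rcases eq_or_ne p.2 0 with hw | hw
  · rw [hw, norm_zero]
    exact (Real.exp_pos _).le
  · have ht := right_ne_zero_of_mul hp
    rw [toricExt_of_notMem (not_or.2 ⟨hz, hw⟩)] at ht
    have hτu : blockiReal p ≤ τ := hprofile (subset_tsupport _ ht)
    rw [blockiReal, neg_le, Real.le_sqrt' (neg_pos.2 hτ), neg_sq] at hτu
    rw [← Real.log_le_iff_le_exp (norm_pos_iff.2 hw), le_div_iff_of_neg hr0]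
    nlinarith

theorem contDiff_toFun : ContDiff ℝ ∞ θ.toFun := by
  obtain ⟨r, s, σ, hs, hσ, hsub⟩ := θ.exists_tsupport_toFun_subset_logBox
  refine contDiff_iff_contDiffAt.2 fun p => ?_
  by_cases hp : p ∈ tsupport θ.toFun
  · have hprofile : ContDiffAt ℝ ∞ (toricExt θ.profile 1) p :=
      (contDiffOn_toricExt θ.contDiff_profile θ.eventually_profile_eq_one).contDiffAt
        (puncturedBidisc.isOpen.mem_nhds (logBox_subset_puncturedBidisc r hs hσ (hsub hp)))
    exact (θ.contDiff_radial.contDiffAt.comp p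
      (contDiffAt_log_norm_fst (fst_ne_zero_of_mem_logBox (hsub hp)))).mul hprofile
  · exact contDiffAt_const.congr_of_eventuallyEq (notMem_tsupport_iff_eventuallyEq.1 hp)

/-- The function `radial (log |z|) * profile (u)` as a test function on the punctured bidisc. -/
noncomputable def testFunction : 𝓓(puncturedBidisc, ℝ) where
  toFun := θ.toFun
  contDiff' := θ.contDiff_toFun
  hasCompactSupport' :=
    have ⟨r, s, σ, _, _, hsub⟩ := θ.exists_tsupport_toFun_subset_logBox
    (isCompact_logBox r s σ).of_isClosed_subset (isClosed_tsupport _) hsub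
  tsupport_subset' :=
    have ⟨r, _, _, hs, hσ, hsub⟩ := θ.exists_tsupport_toFun_subset_logBox
    hsub.trans (logBox_subset_puncturedBidisc r hs hσ)

theorem testFunction_eventuallyEq {p : ℂ × ℂ} (hp : p ∈ toricBidisc) :
    θ.testFunction =ᶠ[𝓝 p] fun q => θ.radial (Real.log ‖q.1‖) * θ.profile (blockiReal q) :=
  (toricExt_eventuallyEq hp θ.profile 1).mono fun q hq =>
    congrArg (θ.radial (Real.log ‖q.1‖) * ·) hq

theorem mongeAmpereDensity_toricExt_ae {g : ℝ → ℝ} (hg : ContDiff ℝ 2 g) (c : ℝ) :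
    mongeAmpereDensity (toricExt g c) θ.testFunction =ᵐ[volume] toricBidisc.indicator fun p =>
      toricDensity g θ.radial θ.profile (Real.log ‖p.1‖) (blockiReal p)
        / (‖p.1‖ ^ 2 * ‖p.2‖ ^ 2) := by
  have htwo : (2 : WithTop ℕ∞) ≤ ∞ := WithTop.coe_le_coe.2 le_top
  filter_upwards [ae_notMem_coordAxes] with p hp
  by_cases hpΩ : p ∈ puncturedBidisc
  · have hp' := mem_toricBidisc_of_notMem_coordAxes hpΩ hp
    rw [indicator_of_mem hp', mongeAmpereDensity_congr (toricExt_eventuallyEq hp' g c)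
      (θ.testFunction_eventuallyEq hp'), mongeAmpereDensity_comp_blockiReal hp' hg.contDiffAt
      (θ.contDiff_radial.of_le htwo).contDiffAt (θ.contDiff_profile.of_le htwo).contDiffAt]
  · have hlevi (b) : leviForm θ.testFunction b p = 0 :=
      eq_zero_of_tsupport_subset
        (compactlySupportedIn_leviForm θ.testFunction b).tsupport_subset hpΩ
    rw [indicator_of_notMem fun h => hpΩ (toricBidisc_subset_puncturedBidisc h)]
    simp [mongeAmpereDensity, mixedDiscr, coeff11, coeff22, coeffRe12, coeffIm12, hlevi]

end ToricCutoff

end ToricCutoff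

/-! ### Integration in logarithmic coordinates -/

section LogCoordinates

theorem exp_image_Iio_zero : Real.exp '' Iio 0 = Ioo 0 1 := by
  ext s
  refine ⟨?_, fun hs => ⟨Real.log s, Real.log_neg hs.1 hs.2, Real.exp_log hs.1⟩⟩
  rintro ⟨y, hy, rfl⟩
  exact ⟨Real.exp_pos y, Real.exp_lt_one_iff.2 hy⟩

theorem setIntegral_Ioo_log (h : ℝ → ℝ) :
    ∫ s in Ioo 0 1, s * (h (Real.log s) / s ^ 2) = ∫ y in Iio 0, h y := by
  rw [← exp_image_Iio_zero, integral_image_eq_integral_abs_deriv_smul measurableSet_Iio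
    (fun y _ => (Real.hasDerivAt_exp y).hasDerivWithinAt) Real.exp_injective.injOn]
  congr 1 with y
  rw [abs_of_pos (Real.exp_pos y), Real.log_exp, smul_eq_mul]
  field_simp

theorem setIntegral_puncturedDisc (h : ℝ → ℝ) :
    ∫ z in puncturedDisc, h (Real.log ‖z‖) / ‖z‖ ^ 2 = 2 * Real.pi * ∫ y in Iio 0, h y := by
  have hpre : puncturedDisc = (‖·‖) ⁻¹' Ioo (0 : ℝ) 1 := by
    ext z
    exact and_congr_left fun _ => norm_pos_iff.symm
  have hball : (volume : Measure ℂ).real (Metric.ball 0 1) = Real.pi := by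
    simp [Measure.real, Complex.volume_ball]
  calc ∫ z in puncturedDisc, h (Real.log ‖z‖) / ‖z‖ ^ 2
      = ∫ z : ℂ, (Ioo (0 : ℝ) 1).indicator (fun s => h (Real.log s) / s ^ 2) ‖z‖ := by
        rw [← integral_indicator isOpen_puncturedDisc.measurableSet, hpre]
        rfl
    _ = 2 * (Real.pi * ∫ s in Ioi 0,
          (Ioo (0 : ℝ) 1).indicator (fun s => s * (h (Real.log s) / s ^ 2)) s) := by
        rw [integral_fun_norm_addHaar, Complex.finrank_real_complex, hball]
        simp only [indicator_mul_right, Nat.add_one_sub_one, pow_one, smul_eq_mul, nsmul_eq_mul,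
          Nat.cast_ofNat]
    _ = 2 * Real.pi * ∫ y in Iio 0, h y := by
        rw [setIntegral_indicator measurableSet_Ioo, inter_eq_right.2 Ioo_subset_Ioi_self,
          setIntegral_Ioo_log, mul_assoc]

theorem sq_div_image_Iio {x : ℝ} (hx : x < 0) : (fun t => t ^ 2 / x) '' Iio 0 = Iio 0 := by
  ext y
  constructor
  · rintro ⟨t, ht, rfl⟩
    exact div_neg_of_pos_of_neg (sq_pos_of_neg ht) hx
  · intro hy
    have hxy : 0 < x * y := mul_pos_of_neg_of_neg hx hy
    refine ⟨-√(x * y), neg_lt_zero.2 (Real.sqrt_pos.2 hxy), ?_⟩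
    simp only [neg_sq, Real.sq_sqrt hxy.le, mul_div_cancel_left₀ y hx.ne]

theorem injOn_sq_div {x : ℝ} (hx : x ≠ 0) : InjOn (fun t => t ^ 2 / x) (Iio 0) := by
  intro s hs t ht hst
  simp only [div_left_inj' hx] at hst
  exact (sq_eq_sq_iff_eq_or_eq_neg.1 hst).resolve_right fun h => by
    linarith [mem_Iio.1 hs, mem_Iio.1 ht]

theorem setIntegral_comp_neg_sqrt_mul {x : ℝ} (hx : x < 0) (h : ℝ → ℝ) :
    ∫ y in Iio 0, h (-√(x * y)) = ∫ t in Iio 0, 2 * t / x * h t := by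
  conv_lhs => rw [← sq_div_image_Iio hx]
  rw [integral_image_eq_integral_abs_deriv_smul measurableSet_Iio (f' := fun t => 2 * t / x)
    (fun t _ => by simpa using ((hasDerivAt_pow 2 t).div_const x).hasDerivWithinAt)
    (injOn_sq_div hx.ne)]
  refine setIntegral_congr_fun measurableSet_Iio fun t (ht : t < 0) => ?_
  have hjac : 0 < 2 * t / x := div_pos_of_neg_of_neg (by linarith) hx
  have hinv : -√(x * (t ^ 2 / x)) = t := by
    rw [mul_div_cancel₀ _ hx.ne, Real.sqrt_sq_eq_abs, abs_of_neg ht, neg_neg]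
  simp only [abs_of_pos hjac, hinv, smul_eq_mul]

theorem setIntegral_toricBidisc {N : ℝ → ℝ → ℝ}
    (hN : IntegrableOn (fun p => N (Real.log ‖p.1‖) (blockiReal p) / (‖p.1‖ ^ 2 * ‖p.2‖ ^ 2))
      toricBidisc) :
    ∫ p in toricBidisc, N (Real.log ‖p.1‖) (blockiReal p) / (‖p.1‖ ^ 2 * ‖p.2‖ ^ 2)
      = 4 * Real.pi ^ 2 * ∫ x in Iio 0, ∫ t in Iio 0, 2 * t / x * N x t := by
  have hfibre : ∀ z ∈ puncturedDisc,
      ∫ w in puncturedDisc, N (Real.log ‖z‖) (blockiReal (z, w)) / (‖z‖ ^ 2 * ‖w‖ ^ 2)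
        = 2 * Real.pi * (∫ t in Iio 0, 2 * t / Real.log ‖z‖ * N (Real.log ‖z‖) t) / ‖z‖ ^ 2 := by
    intro z hz
    rw [← setIntegral_comp_neg_sqrt_mul (log_norm_neg hz), ← setIntegral_puncturedDisc,
      ← integral_div]
    simp only [blockiReal, div_div, mul_comm (‖z‖ ^ 2)]
  rw [toricBidisc, Measure.volume_eq_prod] at hN ⊢
  rw [setIntegral_prod _ hN, setIntegral_congr_fun isOpen_puncturedDisc.measurableSet hfibre,
    setIntegral_puncturedDisc fun x => 2 * Real.pi * ∫ t in Iio 0, 2 * t / x * N x t,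
    integral_const_mul]
  ring

end LogCoordinates

/-! ### The energy of a smooth weight -/

section OneVariable

/-- The open half-line `(-∞, 0)`. -/
abbrev negHalfLine : Opens ℝ := ⟨Iio 0, isOpen_Iio⟩

theorem compactlySupportedIn_negHalfLine {f : ℝ → ℝ} (hf : Continuous f)
    (hsupp : tsupport f ⊆ Iio 0) (hbot : ∀ᶠ t in atBot, f t = 0) :
    CompactlySupportedIn negHalfLine f := by
  obtain ⟨T, hT⟩ := eventually_atBot.1 hbot
  refine ⟨hf, HasCompactSupport.intro (isCompact_Icc (a := T) (b := 0)) fun t ht => ?_, hsupp⟩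
  rcases lt_or_ge t T with h | h
  · exact hT t h.le
  · exact eq_zero_of_tsupport_subset hsupp fun h' => ht ⟨h, le_of_lt h'⟩

theorem tsupport_deriv_subset_tsupport (f : ℝ → ℝ) : tsupport (deriv f) ⊆ tsupport f :=
  closure_minimal support_deriv_subset (isClosed_tsupport f)

theorem CompactlySupportedIn.deriv {Ω : Opens ℝ} {ψ : ℝ → ℝ} (hψ : CompactlySupportedIn Ω ψ)
    (hψ1 : ContDiff ℝ 1 ψ) : CompactlySupportedIn Ω (deriv ψ) :=
  hψ.of_tsupport_subset hψ1.continuous_deriv_one (tsupport_deriv_subset_tsupport ψ)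

theorem CompactlySupportedIn.setIntegral_eq {Ω : Opens ℝ} {ψ : ℝ → ℝ}
    (hψ : CompactlySupportedIn Ω ψ) : ∫ x in (Ω : Set ℝ), ψ x = ∫ x, ψ x :=
  setIntegral_eq_integral_of_forall_compl_eq_zero fun _ hx =>
    eq_zero_of_tsupport_subset hψ.tsupport_subset hx

theorem eventually_atBot_deriv_eq_zero {f : ℝ → ℝ} {c : ℝ} (hf : ∀ᶠ t in atBot, f t = c) :
    ∀ᶠ t in atBot, deriv f t = 0 := by
  obtain ⟨T, hT⟩ := eventually_atBot.1 hf
  filter_upwards [eventually_lt_atBot T] with t ht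
  have hconst : f =ᶠ[𝓝 t] fun _ => c := (eventually_le_nhds ht).mono hT
  rw [hconst.deriv_eq, deriv_const]

theorem integral_mul_deriv_eq_neg {Ω : Opens ℝ} {u ψ : ℝ → ℝ} (hu : ContDiff ℝ 1 u)
    (hψ : CompactlySupportedIn Ω ψ) (hψ1 : ContDiff ℝ 1 ψ) :
    ∫ t, u t * deriv ψ t = -∫ t, deriv u t * ψ t :=
  integral_mul_deriv_eq_deriv_mul_of_integrable
    (fun t _ => (hu.differentiable one_ne_zero t).hasDerivAt)
    (fun t _ => (hψ1.differentiable one_ne_zero t).hasDerivAt)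
    ((hψ.deriv hψ1).integrable_mul_left hu.continuous.continuousOn volume)
    (hψ.integrable_mul_left hu.continuous_deriv_one.continuousOn volume)
    (hψ.integrable_mul_left hu.continuous.continuousOn volume)

theorem integral_deriv_eq_zero {Ω : Opens ℝ} {ψ : ℝ → ℝ} (hψ : CompactlySupportedIn Ω ψ)
    (hψ1 : ContDiff ℝ 1 ψ) : ∫ t, deriv ψ t = 0 :=
  integral_eq_zero_of_hasDerivAt_of_integrable
    (fun t => (hψ1.differentiable one_ne_zero t).hasDerivAt) ((hψ.deriv hψ1).integrable volume)
    (hψ.integrable volume)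

theorem integral_id_mul_deriv {Ω : Opens ℝ} {ψ : ℝ → ℝ} (hψ : CompactlySupportedIn Ω ψ)
    (hψ1 : ContDiff ℝ 1 ψ) : ∫ t, t * deriv ψ t = -∫ t, ψ t := by
  have hparts := integral_mul_deriv_eq_neg contDiff_id hψ hψ1
  simpa only [id, deriv_id', one_mul] using hparts

theorem integral_integral_separated {X Y : Type*} [MeasurableSpace X] [MeasurableSpace Y]
    {μ : Measure X} {ν : Measure Y} {a₁ a₂ a₃ : X → ℝ} {k₁ k₂ k₃ : Y → ℝ}
    (ha₁ : Integrable a₁ μ) (ha₂ : Integrable a₂ μ) (ha₃ : Integrable a₃ μ)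
    (hk₁ : Integrable k₁ ν) (hk₂ : Integrable k₂ ν) (hk₃ : Integrable k₃ ν) :
    ∫ x, ∫ y, (a₁ x * k₁ y + a₂ x * k₂ y - a₃ x * k₃ y) ∂ν ∂μ
      = (∫ x, a₁ x ∂μ) * ∫ y, k₁ y ∂ν + (∫ x, a₂ x ∂μ) * ∫ y, k₂ y ∂ν
        - (∫ x, a₃ x ∂μ) * ∫ y, k₃ y ∂ν := by
  have hinner (x) : ∫ y, (a₁ x * k₁ y + a₂ x * k₂ y - a₃ x * k₃ y) ∂ν
      = a₁ x * ∫ y, k₁ y ∂ν + a₂ x * ∫ y, k₂ y ∂ν - a₃ x * ∫ y, k₃ y ∂ν := by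
    rw [integral_sub ((hk₁.const_mul _).fun_add (hk₂.const_mul _)) (hk₃.const_mul _),
      integral_add (hk₁.const_mul _) (hk₂.const_mul _), integral_const_mul, integral_const_mul,
      integral_const_mul]
  simp only [hinner]
  rw [integral_sub ((ha₁.mul_const _).fun_add (ha₂.mul_const _)) (ha₃.mul_const _),
    integral_add (ha₁.mul_const _) (ha₂.mul_const _), integral_mul_const, integral_mul_const,
    integral_mul_const]

theorem two_mul_div_mul_toricDensity (g α B : ℝ → ℝ) {x t : ℝ} (hx : x ≠ 0) (ht : t ≠ 0) :
    2 * t / x * toricDensity g α B x t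
      = x⁻¹ * α x * (-(1 / 2) * (g t * (deriv (deriv g) t * deriv B t
          + deriv g t * deriv (deriv B) t)))
        + x * deriv (deriv α) x * (g t / (2 * t) * (B t * deriv (deriv g) t)
          - g t / (2 * t ^ 2) * (B t * deriv g t))
        - deriv α x * (g t * deriv g t / t * deriv B t) := by
  simp only [toricDensity, hessDiag]
  field_simp
  ring

end OneVariable

section Energy

theorem IsSmoothWeight.contDiff_deriv {g : ℝ → ℝ} {c : ℝ} (hg : IsSmoothWeight g c) :
    ContDiff ℝ ∞ (deriv g) := (contDiff_infty_iff_deriv.1 hg.contDiff).2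

theorem IsSmoothWeight.contDiff_deriv_deriv {g : ℝ → ℝ} {c : ℝ} (hg : IsSmoothWeight g c) :
    ContDiff ℝ ∞ (deriv (deriv g)) := (contDiff_infty_iff_deriv.1 hg.contDiff_deriv).2

namespace ToricCutoff

variable (θ : ToricCutoff)

theorem contDiff_deriv_radial : ContDiff ℝ ∞ (deriv θ.radial) :=
  (contDiff_infty_iff_deriv.1 θ.contDiff_radial).2

theorem contDiff_deriv_profile : ContDiff ℝ ∞ (deriv θ.profile) :=
  (contDiff_infty_iff_deriv.1 θ.contDiff_profile).2

theorem compactlySupportedIn_radial : CompactlySupportedIn negHalfLine θ.radial :=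
  ⟨θ.contDiff_radial.continuous, θ.hasCompactSupport_radial, θ.tsupport_radial_subset⟩

theorem compactlySupportedIn_deriv_radial : CompactlySupportedIn negHalfLine (deriv θ.radial) :=
  θ.compactlySupportedIn_radial.deriv (θ.contDiff_radial.of_le (mod_cast le_top))

theorem compactlySupportedIn_profile_mul {f : ℝ → ℝ} (hf : Continuous f)
    (hbot : ∀ᶠ t in atBot, f t = 0) :
    CompactlySupportedIn negHalfLine fun t => θ.profile t * f t :=
  compactlySupportedIn_negHalfLine (θ.contDiff_profile.continuous.mul hf)
    (tsupport_mul_subset_left.trans θ.tsupport_profile_subset)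
    (hbot.mono fun t ht => by rw [ht, mul_zero])

theorem compactlySupportedIn_deriv_profile : CompactlySupportedIn negHalfLine (deriv θ.profile) :=
  compactlySupportedIn_negHalfLine θ.contDiff_deriv_profile.continuous
    ((tsupport_deriv_subset_tsupport _).trans θ.tsupport_profile_subset)
    (eventually_atBot_deriv_eq_zero θ.eventually_profile_eq_one)

theorem compactlySupportedIn_deriv_deriv_profile :
    CompactlySupportedIn negHalfLine (deriv (deriv θ.profile)) :=
  θ.compactlySupportedIn_deriv_profile.deriv (θ.contDiff_deriv_profile.of_le (mod_cast le_top))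

theorem integral_deriv_profile : ∫ t, deriv θ.profile t = -1 := by
  have hbot : Tendsto θ.profile atBot (𝓝 1) :=
    tendsto_const_nhds.congr' (θ.eventually_profile_eq_one.mono fun _ => Eq.symm)
  have htop : Tendsto θ.profile atTop (𝓝 0) :=
    tendsto_const_nhds.congr' ((eventually_ge_atTop 0).mono fun t ht =>
      (eq_zero_of_tsupport_subset θ.tsupport_profile_subset (notMem_Iio.2 ht)).symm)
  rw [integral_of_hasDerivAt_of_tendsto
    (fun t => ((θ.contDiff_profile.differentiable (by simp)) t).hasDerivAt)
    (θ.compactlySupportedIn_deriv_profile.integrable volume) hbot htop, zero_sub]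

theorem integral_id_mul_deriv_deriv_profile : ∫ t, t * deriv (deriv θ.profile) t = 1 := by
  rw [integral_id_mul_deriv θ.compactlySupportedIn_deriv_profile
    (θ.contDiff_deriv_profile.of_le (mod_cast le_top)), θ.integral_deriv_profile, neg_neg]

/-- The mass `∫ radial x / |x| dx`, by which `(dd^c g(u))²` charges the radial factor of the
test function. -/
noncomputable def mass : ℝ := -∫ x in Iio 0, x⁻¹ * θ.radial x

theorem compactlySupportedIn_inv_mul_radial :
    CompactlySupportedIn negHalfLine fun x => x⁻¹ * θ.radial x :=
  θ.compactlySupportedIn_radial.mul_left (continuousOn_inv₀.mono fun _ hx => ne_of_lt hx)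

theorem mass_pos : 0 < θ.mass := by
  obtain ⟨x₀, hx₀⟩ := θ.exists_radial_ne_zero
  have hx₀neg : x₀ < 0 := θ.tsupport_radial_subset (subset_tsupport _ hx₀)
  have hsupp := θ.compactlySupportedIn_inv_mul_radial
  have hset : ∫ x in Iio 0, x⁻¹ * θ.radial x = ∫ x, x⁻¹ * θ.radial x := hsupp.setIntegral_eq
  have hnonneg (x : ℝ) : 0 ≤ -(x⁻¹ * θ.radial x) := by
    rcases lt_or_ge x 0 with hx | hx
    · exact neg_nonneg.2 (mul_nonpos_of_nonpos_of_nonneg (inv_nonpos.2 hx.le) (θ.radial_nonneg x))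
    · simp [eq_zero_of_tsupport_subset θ.tsupport_radial_subset (notMem_Iio.2 hx)]
  rw [mass, hset, ← integral_neg]
  exact hsupp.continuous.neg.integral_pos_of_hasCompactSupport_nonneg_nonzero
    hsupp.hasCompactSupport.neg hnonneg
    (neg_ne_zero.2 (mul_ne_zero (inv_ne_zero hx₀neg.ne) hx₀))

variable {g : ℝ → ℝ} {c : ℝ}

theorem setIntegral_deriv_radial : ∫ x in Iio 0, deriv θ.radial x = 0 :=
  θ.compactlySupportedIn_deriv_radial.setIntegral_eq.trans <|
    integral_deriv_eq_zero θ.compactlySupportedIn_radial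
      (θ.contDiff_radial.of_le (mod_cast le_top))

theorem compactlySupportedIn_id_mul_deriv_deriv_radial :
    CompactlySupportedIn negHalfLine fun x => x * deriv (deriv θ.radial) x :=
  (θ.compactlySupportedIn_deriv_radial.deriv
    (θ.contDiff_deriv_radial.of_le (mod_cast le_top))).mul_left continuousOn_id

theorem setIntegral_id_mul_deriv_deriv_radial :
    ∫ x in Iio 0, x * deriv (deriv θ.radial) x = 0 := by
  refine θ.compactlySupportedIn_id_mul_deriv_deriv_radial.setIntegral_eq.trans ?_
  rw [integral_id_mul_deriv θ.compactlySupportedIn_deriv_radial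
      (θ.contDiff_deriv_radial.of_le (mod_cast le_top)),
    integral_deriv_eq_zero θ.compactlySupportedIn_radial
      (θ.contDiff_radial.of_le (mod_cast le_top)), neg_zero]

theorem deriv_deriv_mul_deriv_profile (hg : ContDiff ℝ ∞ g) (t : ℝ) :
    deriv (fun s => deriv g s * deriv θ.profile s) t
      = deriv (deriv g) t * deriv θ.profile t + deriv g t * deriv (deriv θ.profile) t :=
  deriv_fun_mul ((contDiff_infty_iff_deriv.1 hg).2.differentiable (by simp) t)
    (θ.contDiff_deriv_profile.differentiable (by simp) t)

theorem contDiff_deriv_mul_deriv_profile (hg : ContDiff ℝ ∞ g) :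
    ContDiff ℝ 1 fun t => deriv g t * deriv θ.profile t :=
  ((contDiff_infty_iff_deriv.1 hg).2.mul θ.contDiff_deriv_profile).of_le (mod_cast le_top)

theorem compactlySupportedIn_deriv_mul_deriv_profile (hg : ContDiff ℝ ∞ g) :
    CompactlySupportedIn negHalfLine fun t => deriv g t * deriv θ.profile t :=
  θ.compactlySupportedIn_deriv_profile.mul_left
    (contDiff_infty_iff_deriv.1 hg).2.continuous.continuousOn

theorem compactlySupportedIn_mul_deriv_mul_deriv_profile (hg : ContDiff ℝ ∞ g) :
    CompactlySupportedIn negHalfLine fun t => g t *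
      (deriv (deriv g) t * deriv θ.profile t + deriv g t * deriv (deriv θ.profile) t) := by
  simp only [← θ.deriv_deriv_mul_deriv_profile hg]
  exact ((θ.compactlySupportedIn_deriv_mul_deriv_profile hg).deriv
    (θ.contDiff_deriv_mul_deriv_profile hg)).mul_left hg.continuous.continuousOn

theorem setIntegral_mul_deriv_mul_deriv_profile (hg : ContDiff ℝ ∞ g) :
    ∫ t in Iio 0, g t *
        (deriv (deriv g) t * deriv θ.profile t + deriv g t * deriv (deriv θ.profile) t)
      = -∫ t, deriv g t ^ 2 * deriv θ.profile t := by
  refine (θ.compactlySupportedIn_mul_deriv_mul_deriv_profile hg).setIntegral_eq.trans ?_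
  simp only [← θ.deriv_deriv_mul_deriv_profile hg]
  rw [integral_mul_deriv_eq_neg (hg.of_le (mod_cast le_top))
    (θ.compactlySupportedIn_deriv_mul_deriv_profile hg) (θ.contDiff_deriv_mul_deriv_profile hg)]
  simp only [← mul_assoc, ← sq]

theorem setIntegral_setIntegral_toricDensity (hg : IsSmoothWeight g c) :
    ∫ x in Iio 0, ∫ t in Iio 0, 2 * t / x * toricDensity g θ.radial θ.profile x t
      = θ.mass / 2 * ∫ t, deriv g t ^ 2 * -deriv θ.profile t := by
  have hg0 := hg.contDiff.continuous
  have hg' := hg.contDiff_deriv.continuous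
  have hbot' := eventually_atBot_deriv_eq_zero hg.eventually_eq
  have ne_zero_of_mem : ∀ t ∈ (negHalfLine : Set ℝ), t ≠ 0 := fun _ ht => ne_of_lt ht
  have hk₁ := θ.compactlySupportedIn_mul_deriv_mul_deriv_profile hg.contDiff
  have hk₂ : Integrable fun t => g t / (2 * t) * (θ.profile t * deriv (deriv g) t)
      - g t / (2 * t ^ 2) * (θ.profile t * deriv g t) :=
    ((θ.compactlySupportedIn_profile_mul hg.contDiff_deriv_deriv.continuous
        (eventually_atBot_deriv_eq_zero hbot')).integrable_mul_left
      (hg0.continuousOn.div (by fun_prop)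
        fun t ht => mul_ne_zero two_ne_zero (ne_zero_of_mem t ht)) volume).sub'
    ((θ.compactlySupportedIn_profile_mul hg' hbot').integrable_mul_left
      (hg0.continuousOn.div (by fun_prop)
        fun t ht => mul_ne_zero two_ne_zero (pow_ne_zero 2 (ne_zero_of_mem t ht))) volume)
  have hk₃ : Integrable fun t => g t * deriv g t / t * deriv θ.profile t :=
    θ.compactlySupportedIn_deriv_profile.integrable_mul_left
      ((hg0.mul hg').continuousOn.div continuousOn_id ne_zero_of_mem) volume
  rw [setIntegral_congr_fun measurableSet_Iio fun x hx => setIntegral_congr_fun measurableSet_Iio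
    fun t ht => two_mul_div_mul_toricDensity g θ.radial θ.profile (ne_of_lt hx) (ne_of_lt ht),
    integral_integral_separated (θ.compactlySupportedIn_inv_mul_radial.integrable volume).restrict
      (θ.compactlySupportedIn_id_mul_deriv_deriv_radial.integrable volume).restrict
      (θ.compactlySupportedIn_deriv_radial.integrable volume).restrict
      ((hk₁.integrable volume).const_mul _).restrict hk₂.restrict hk₃.restrict,
    θ.setIntegral_deriv_radial, θ.setIntegral_id_mul_deriv_deriv_radial, integral_const_mul,
    θ.setIntegral_mul_deriv_mul_deriv_profile hg.contDiff]
  simp only [mass, mul_neg, integral_neg]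
  ring

theorem mongeAmpere_toricExt (hg : IsSmoothWeight g c) :
    mongeAmpere puncturedBidisc (toricExt g c) θ.testFunction
      = 2 * Real.pi ^ 2 * θ.mass * ∫ t, deriv g t ^ 2 * -deriv θ.profile t := by
  have hae := θ.mongeAmpereDensity_toricExt_ae hg.contDiff_two c
  have hmeas : MeasurableSet toricBidisc := isOpen_toricBidisc.measurableSet
  have hint := (integrable_indicator_iff hmeas).1
    ((integrable_mongeAmpereDensity hg.contDiffOn_toricExt θ.testFunction).congr hae)
  rw [mongeAmpere_of_contDiffOn hg.contDiffOn_toricExt hg.aeLeviNonneg_toricExt,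
    integral_congr_ae hae, integral_indicator hmeas, setIntegral_toricBidisc hint,
    θ.setIntegral_setIntegral_toricDensity hg]
  ring

-- Since `-profile' ≥ 0`, this is `(g' - 1)² ≥ 0` integrated.
theorem le_integral_energy (hg : ContDiff ℝ ∞ g) :
    2 * (∫ t, g t * deriv (deriv θ.profile) t) - 1 ≤ ∫ t, deriv g t ^ 2 * -deriv θ.profile t := by
  have hg' : ContDiff ℝ ∞ (deriv g) := (contDiff_infty_iff_deriv.1 hg).2
  have hprofile' := θ.compactlySupportedIn_deriv_profile
  have hint' := (θ.compactlySupportedIn_deriv_mul_deriv_profile hg).integrable volume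
  have hparts := integral_mul_deriv_eq_neg (hg.of_le (mod_cast le_top)) hprofile'
    (θ.contDiff_deriv_profile.of_le (mod_cast le_top))
  calc 2 * (∫ t, g t * deriv (deriv θ.profile) t) - 1
      = ∫ t, (-2 * (deriv g t * deriv θ.profile t) + deriv θ.profile t) := by
        rw [integral_add (hint'.const_mul _) (hprofile'.integrable volume), integral_const_mul,
          θ.integral_deriv_profile, hparts]
        ring
    _ ≤ ∫ t, deriv g t ^ 2 * -deriv θ.profile t := by
        refine integral_mono ((hint'.const_mul _).fun_add (hprofile'.integrable volume)) ?_
          fun t => ?_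
        · simpa only [mul_neg] using
            (hprofile'.integrable_mul_left (hg'.pow 2).continuous.continuousOn volume).fun_neg
        · have hnonpos : deriv θ.profile t ≤ 0 := θ.antitone_profile.deriv_nonpos
          nlinarith [mul_nonneg (sq_nonneg (deriv g t - 1)) (neg_nonneg.2 hnonpos)]

theorem le_mongeAmpere_toricExt (hg : IsSmoothWeight g c) :
    2 * Real.pi ^ 2 * θ.mass * (2 * (∫ t, g t * deriv (deriv θ.profile) t) - 1)
      ≤ mongeAmpere puncturedBidisc (toricExt g c) θ.testFunction := by
  have hmass := θ.mass_pos
  rw [θ.mongeAmpere_toricExt hg]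
  gcongr
  exact θ.le_integral_energy hg.contDiff

end ToricCutoff

end Energy

/-! ### Smoothing convex weights -/

section Mollifier

/-- The mollification of `F` by the bump function `φ` normalised to have integral one. -/
noncomputable def mollify (φ : ContDiffBump (0 : ℝ)) (F : ℝ → ℝ) : ℝ → ℝ :=
  φ.normed volume ⋆[ContinuousLinearMap.lsmul ℝ ℝ, volume] F

variable (φ : ContDiffBump (0 : ℝ)) {F : ℝ → ℝ}

theorem mollify_apply (F : ℝ → ℝ) (t : ℝ) :
    mollify φ F t = ∫ s, φ.normed volume s * F (t - s) := rfl

theorem mollify_const (c t : ℝ) : mollify φ (fun _ => c) t = c := by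
  rw [mollify_apply, integral_mul_const, φ.integral_normed, one_mul]

theorem contDiff_mollify (hF : Monotone F) : ContDiff ℝ ∞ (mollify φ F) :=
  φ.hasCompactSupport_normed.contDiff_convolution_left _ (φ.contDiff_normed (n := ⊤))
    hF.locallyIntegrable

theorem integrable_normed_mul_sub (hF : Monotone F) (t : ℝ) :
    Integrable fun s => φ.normed volume s * F (t - s) :=
  φ.hasCompactSupport_normed.convolutionExists_left (ContinuousLinearMap.lsmul ℝ ℝ)
    φ.continuous_normed hF.locallyIntegrable t

theorem normed_mul_le_normed_mul {s a b : ℝ} (h : |s| < φ.rOut → a ≤ b) :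
    φ.normed volume s * a ≤ φ.normed volume s * b := by
  by_cases hs : |s| < φ.rOut
  · exact mul_le_mul_of_nonneg_left (h hs) (φ.nonneg_normed s)
  · have hzero : φ.normed volume s = 0 := by
      rw [← Function.notMem_support, φ.support_normed_eq, mem_ball_zero_iff]
      exact hs
    rw [hzero, zero_mul, zero_mul]

theorem mollify_le_mollify {G : ℝ → ℝ} (hF : Monotone F) (hG : Monotone G) {s t : ℝ}
    (h : ∀ r, |r| < φ.rOut → F (s - r) ≤ G (t - r)) : mollify φ F s ≤ mollify φ G t :=
  integral_mono (integrable_normed_mul_sub φ hF s) (integrable_normed_mul_sub φ hG t)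
    fun r => normed_mul_le_normed_mul φ (h r)

theorem monotone_mollify (hF : Monotone F) : Monotone (mollify φ F) := fun _ _ hst =>
  mollify_le_mollify φ hF hF fun r _ => hF (sub_le_sub_right hst r)

theorem le_mollify (hF : Monotone F) (t : ℝ) : F (t - φ.rOut) ≤ mollify φ F t := by
  rw [← mollify_const φ (F (t - φ.rOut)) t]
  exact mollify_le_mollify φ monotone_const hF fun r hr =>
    hF (sub_le_sub_left (abs_lt.1 hr).2.le t)

theorem mollify_le (hF : Monotone F) (t : ℝ) : mollify φ F t ≤ F (t + φ.rOut) := by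
  rw [← mollify_const φ (F (t + φ.rOut)) t]
  exact mollify_le_mollify φ hF monotone_const fun r hr => hF (by linarith [(abs_lt.1 hr).1])

theorem convexOn_mollify (hF : Monotone F) {b : ℝ} (hconv : ConvexOn ℝ (Iio (b + φ.rOut)) F) :
    ConvexOn ℝ (Iio b) (mollify φ F) := by
  refine ⟨convex_Iio b, fun s hs t ht x y hx hy hxy => ?_⟩
  have hint (t) := integrable_normed_mul_sub φ hF t
  simp only [smul_eq_mul, mollify_apply]
  rw [← integral_const_mul, ← integral_const_mul,
    ← integral_add ((hint s).const_mul x) ((hint t).const_mul y)]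
  refine integral_mono (hint _) (((hint s).const_mul x).fun_add ((hint t).const_mul y))
    fun r => (normed_mul_le_normed_mul φ fun hr => ?_).trans_eq
      (show _ * (x * F (s - r) + y * F (t - r)) = _ by ring)
  have hmem {u : ℝ} (hu : u < b) : u - r ∈ Iio (b + φ.rOut) := by
    rw [mem_Iio]
    linarith [(abs_lt.1 hr).1]
  have hsplit : x * s + y * t - r = x • (s - r) + y • (t - r) := by
    simp only [smul_eq_mul]
    linear_combination r * hxy
  rw [hsplit]
  exact hconv.2 (hmem hs) (hmem ht) hx hy hxy

end Mollifier

/-- The functions `χ` for which `χ(u)` is a bounded-below plurisubharmonic function. -/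
structure IsWeight (χ : ℝ → ℝ) : Prop where
  bddBelow : BddBelow (χ '' Iio 0)
  convexOn : ConvexOn ℝ (Iio 0) χ
  monotoneOn : MonotoneOn χ (Iio 0)

/-- The truncation of `χ` from below at level `c`, shifted by `2δ` to the right and frozen to the
right of `δ`, so that it is monotone on the whole line. -/
noncomputable def truncate (χ : ℝ → ℝ) (c δ t : ℝ) : ℝ := max (χ (min (t - 2 * δ) (-δ))) c

namespace IsWeight

variable {χ : ℝ → ℝ} {δ : ℝ}

theorem continuousOn (hχ : IsWeight χ) : ContinuousOn χ (Iio 0) :=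
  hχ.convexOn.continuousOn isOpen_Iio

theorem sInf_le (hχ : IsWeight χ) {t : ℝ} (ht : t < 0) : sInf (χ '' Iio 0) ≤ χ t :=
  csInf_le hχ.bddBelow (mem_image_of_mem χ ht)

theorem monotone_truncate (hχ : IsWeight χ) (c : ℝ) (hδ : 0 < δ) : Monotone (truncate χ c δ) := by
  have hneg (t : ℝ) : min (t - 2 * δ) (-δ) < 0 := (min_le_right _ _).trans_lt (neg_lt_zero.2 hδ)
  exact fun s t hst => max_le_max_right c <|
    hχ.monotoneOn (hneg s) (hneg t) (min_le_min_right _ (sub_le_sub_right hst _))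

theorem convexOn_truncate (hχ : IsWeight χ) (c : ℝ) (hδ : 0 < δ) :
    ConvexOn ℝ (Iio δ) (truncate χ c δ) := by
  have hshift : ConvexOn ℝ (Iio δ) fun t => χ (t + -(2 * δ)) :=
    (hχ.convexOn.translate_left (-(2 * δ))).subset
      (fun t ht => by
        simp only [mem_Iio, mem_preimage] at ht ⊢
        linarith) (convex_Iio δ)
  refine (hshift.sup (convexOn_const c (convex_Iio δ))).congr fun t ht => ?_
  have hmin : min (t - 2 * δ) (-δ) = t + -(2 * δ) := by
    rw [min_eq_left, sub_eq_add_neg]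
    linarith [mem_Iio.1 ht]
  simp only [truncate, hmin, Pi.sup_apply]

theorem eventually_truncate_eq (hχ : IsWeight χ) (hδ : 0 < δ) {c : ℝ}
    (hc : sInf (χ '' Iio 0) < c) : ∀ᶠ t in atBot, truncate χ c δ t = c := by
  obtain ⟨_, ⟨t₀, ht₀, rfl⟩, hlt⟩ :=
    exists_lt_of_csInf_lt ((nonempty_Iio (a := (0 : ℝ))).image χ) hc
  filter_upwards [eventually_le_atBot t₀] with t ht
  have hle : min (t - 2 * δ) (-δ) ≤ t₀ := (min_le_left _ _).trans (by linarith)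
  exact max_eq_right ((hχ.monotoneOn (hle.trans_lt ht₀) ht₀ hle).trans hlt.le)

theorem exists_isSmoothWeight_pinched (hχ : IsWeight χ) (hδ : 0 < δ) :
    ∃ g, IsSmoothWeight g (sInf (χ '' Iio 0) + δ) ∧
      ∀ t < 0, χ (t - 3 * δ) ≤ g t ∧ g t ≤ χ t + δ := by
  set c := sInf (χ '' Iio 0) + δ
  let φ : ContDiffBump (0 : ℝ) := ⟨δ / 2, δ, half_pos hδ, half_lt_self hδ⟩
  have hmono := hχ.monotone_truncate c hδ
  have hconst := hχ.eventually_truncate_eq hδ (lt_add_of_pos_right _ hδ : _ < c)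
  refine ⟨mollify φ (truncate χ c δ), ⟨contDiff_mollify φ hmono, ?_,
    (monotone_mollify φ hmono).monotoneOn _,
    convexOn_mollify φ hmono (by simpa only [zero_add] using hχ.convexOn_truncate c hδ)⟩,
    fun t ht => ⟨?_, ?_⟩⟩
  · filter_upwards [(tendsto_atBot_add_const_right _ (-δ) tendsto_id).eventually hconst,
      (tendsto_atBot_add_const_right _ δ tendsto_id).eventually hconst] with t hleft hright
    exact le_antisymm ((mollify_le φ hmono t).trans_eq hright)
      (hleft.symm.trans_le (le_mollify φ hmono t))
  · have hmin : min (t - δ - 2 * δ) (-δ) = t - 3 * δ := by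
      rw [min_eq_left] <;> linarith
    calc χ (t - 3 * δ) ≤ truncate χ c δ (t - δ) := by
          rw [truncate, hmin]
          exact le_max_left _ _
      _ ≤ mollify φ (truncate χ c δ) t := le_mollify φ hmono t
  · have hle : min (t + δ - 2 * δ) (-δ) ≤ t := (min_le_left _ _).trans (by linarith)
    calc mollify φ (truncate χ c δ) t ≤ truncate χ c δ (t + δ) := mollify_le φ hmono t
      _ ≤ χ t + δ := max_le
          ((hχ.monotoneOn (hle.trans_lt ht) ht hle).trans (le_add_of_nonneg_right hδ.le))
          (add_le_add_left (hχ.sInf_le ht) δ)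

end IsWeight

section Approximation

theorem sub_le_sub_of_convexOn {s : Set ℝ} {f : ℝ → ℝ} (hf : ConvexOn ℝ s f) {t b h : ℝ}
    (hth : t - h ∈ s) (hb : b ∈ s) (htb : t ≤ b) (hh : 0 ≤ h) :
    f t - f (t - h) ≤ f b - f (b - h) := by
  rcases hh.eq_or_lt with rfl | hh
  · simp
  have hpos : 0 < b - t + h := by linarith
  have hbt := div_nonneg (sub_nonneg.2 htb) hpos.le
  have hhd := div_nonneg hh.le hpos.le
  have hsum : (b - t) / (b - t + h) + h / (b - t + h) = 1 := by field_simp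
  have hft := hf.2 hth hb hbt hhd hsum
  have hfb := hf.2 hth hb hhd hbt (by rw [add_comm, hsum])
  have et : ((b - t) / (b - t + h)) • (t - h) + (h / (b - t + h)) • b = t := by
    simp only [smul_eq_mul]
    field_simp
    ring
  have eb : (h / (b - t + h)) • (t - h) + ((b - t) / (b - t + h)) • b = b - h := by
    simp only [smul_eq_mul]
    field_simp
    ring
  rw [et] at hft
  rw [eb] at hfb
  simp only [smul_eq_mul] at hft hfb
  linear_combination hft + hfb + (f (t - h) + f b) * hsum

variable {χ : ℝ → ℝ} {ι : Type*} {l : Filter ι} {δ : ι → ℝ} {g : ι → ℝ → ℝ}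

theorem tendsto_comp_sub_three_mul (hχ : ContinuousOn χ (Iio 0)) (hδ : Tendsto δ l (𝓝 0)) {t : ℝ}
    (ht : t < 0) : Tendsto (fun n => χ (t - 3 * δ n)) l (𝓝 (χ t)) := by
  have harg : Tendsto (fun n => t - 3 * δ n) l (𝓝 t) := by
    simpa using (hδ.const_mul 3).const_sub t
  exact (hχ.continuousAt (Iio_mem_nhds ht)).tendsto.comp harg

theorem tendsto_of_pinched (hχ : ContinuousOn χ (Iio 0)) (hδ : Tendsto δ l (𝓝 0))
    (hpinch : ∀ n, ∀ t < 0, χ (t - 3 * δ n) ≤ g n t ∧ g n t ≤ χ t + δ n) {t : ℝ} (ht : t < 0) :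
    Tendsto (fun n => g n t) l (𝓝 (χ t)) :=
  tendsto_of_tendsto_of_tendsto_of_le_of_le (tendsto_comp_sub_three_mul hχ hδ ht)
    (by simpa using hδ.const_add (χ t)) (fun n => (hpinch n t ht).1) fun n => (hpinch n t ht).2

theorem dist_toricExt_le (hχ : ConvexOn ℝ (Iio 0) χ) {c η b : ℝ} {f : ℝ → ℝ} (hη : 0 ≤ η)
    (hb : b < 0) (hpinch : ∀ t < 0, χ (t - 3 * η) ≤ f t ∧ f t ≤ χ t + η) {p : ℂ × ℂ}
    (hp : p ∉ coordAxes → blockiReal p ≤ b) :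
    dist (toricExt χ c p) (toricExt f (c + η) p) ≤ max η (χ b - χ (b - 3 * η)) := by
  by_cases hax : p ∈ coordAxes
  · rw [toricExt_of_mem hax, toricExt_of_mem hax, Real.dist_eq, sub_add_cancel_left, abs_neg,
      abs_of_nonneg hη]
    exact le_max_left _ _
  · have hneg : blockiReal p < 0 := (hp hax).trans_lt hb
    have hshift : blockiReal p - 3 * η ∈ Iio 0 := by
      rw [mem_Iio]
      linarith
    have hincr := sub_le_sub_of_convexOn hχ hshift hb (hp hax) (by positivity : 0 ≤ 3 * η)
    obtain ⟨hlower, hupper⟩ := hpinch _ hneg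
    rw [toricExt_of_notMem hax, toricExt_of_notMem hax, Real.dist_eq, abs_sub_le_iff]
    exact ⟨le_max_of_le_right (by linarith), le_max_of_le_left (by linarith)⟩

-- Increments of a convex function are non-decreasing, so the rate at `b` is a rate on `(-∞, b]`.
theorem tendstoLocallyUniformlyOn_toricExt (hχ : IsWeight χ) (c : ℝ) (hδpos : ∀ n, 0 < δ n)
    (hδ : Tendsto δ l (𝓝 0))
    (hpinch : ∀ n, ∀ t < 0, χ (t - 3 * δ n) ≤ g n t ∧ g n t ≤ χ t + δ n) :
    TendstoLocallyUniformlyOn (fun n => toricExt (g n) (c + δ n)) (toricExt χ c) l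
      puncturedBidisc := by
  refine Metric.tendstoLocallyUniformlyOn_iff.2 fun ε hε p hp => ?_
  obtain ⟨b, hb, hnear⟩ := exists_neg_eventually_blockiReal_le hp
  have hrate : Tendsto (fun n => max (δ n) (χ b - χ (b - 3 * δ n))) l (𝓝 0) := by
    simpa using hδ.max ((tendsto_comp_sub_three_mul hχ.continuousOn hδ hb).const_sub (χ b))
  refine ⟨_, mem_nhdsWithin_of_mem_nhds hnear, ?_⟩
  filter_upwards [hrate.eventually_lt_const hε] with n hn q hq
  exact (dist_toricExt_le hχ.convexOn (hδpos n).le hb (hpinch n) hq).trans_lt hn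

theorem IsWeight.exists_approx (hχ : IsWeight χ) :
    ∃ (g : ℕ → ℝ → ℝ) (c : ℕ → ℝ), (∀ n, IsSmoothWeight (g n) (c n)) ∧
      (∀ t < 0, Tendsto (fun n => g n t) atTop (𝓝 (χ t))) ∧
      TendstoLocallyUniformlyOn (fun n => toricExt (g n) (c n))
        (toricExt χ (sInf (χ '' Iio 0))) atTop puncturedBidisc := by
  have hδ : Tendsto (fun n : ℕ => 1 / ((n : ℝ) + 1)) atTop (𝓝 0) :=
    tendsto_one_div_add_atTop_nhds_zero_nat
  choose g hg hpinch using fun n : ℕ =>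
    hχ.exists_isSmoothWeight_pinched (Nat.one_div_pos_of_nat (α := ℝ) (n := n))
  exact ⟨g, _, hg, fun t ht => tendsto_of_pinched hχ.continuousOn hδ hpinch ht,
    tendstoLocallyUniformlyOn_toricExt hχ _ (fun n => Nat.one_div_pos_of_nat) hδ hpinch⟩

end Approximation

/-! ### The lower bound for convex weights -/

section LowerBound

-- Monotonicity turns convergence at the two endpoints of the support of `k` into a bound.
theorem tendsto_integral_mul_of_monotoneOn {ι : Type*} {l : Filter ι} [l.IsCountablyGenerated]
    {f : ι → ℝ → ℝ} {f₀ k : ℝ → ℝ} (hk : CompactlySupportedIn negHalfLine k)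
    (hcont : ∀ n, ContinuousOn (f n) (Iio 0)) (hmono : ∀ n, MonotoneOn (f n) (Iio 0))
    (hlim : ∀ t < 0, Tendsto (fun n => f n t) l (𝓝 (f₀ t))) :
    Tendsto (fun n => ∫ t, f n t * k t) l (𝓝 (∫ t, f₀ t * k t)) := by
  obtain ⟨b, hb, hkb⟩ := exists_neg_tsupport_subset_Iic hk.tsupport_subset
  obtain ⟨a, hka⟩ := hk.hasCompactSupport.isCompact.bddBelow
  have hab : min a b < 0 := (min_le_right a b).trans_lt hb
  refine tendsto_integral_filter_of_dominated_convergence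
    (fun t => (|f₀ (min a b)| + |f₀ b| + 1) * |k t|)
    (Eventually.of_forall fun n => (hk.integrable_mul_left (hcont n) volume).aestronglyMeasurable)
    ?_ ((hk.integrable volume).abs.const_mul _) (ae_of_all _ fun t => ?_)
  · have hbound : ∀ᶠ n in l, |f n (min a b)| + |f n b| < |f₀ (min a b)| + |f₀ b| + 1 :=
      ((hlim _ hab).abs.add (hlim b hb).abs).eventually_lt_const (lt_add_one _)
    filter_upwards [hbound] with n hn
    refine ae_of_all _ fun t => ?_
    by_cases ht : t ∈ tsupport k
    · have htb : t ≤ b := hkb ht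
      have hat : min a b ≤ t := (min_le_left a b).trans (hka ht)
      have ht0 : t < 0 := htb.trans_lt hb
      rw [Real.norm_eq_abs, abs_mul]
      gcongr
      exact (abs_le_max_abs_abs (hmono n hab ht0 hat) (hmono n ht0 hb htb)).trans
        ((max_le_add_of_nonneg (abs_nonneg _) (abs_nonneg _)).trans hn.le)
    · simp [image_eq_zero_of_notMem_tsupport ht]
  · by_cases ht : t ∈ tsupport k
    · exact (hlim t (hk.tsupport_subset ht)).mul_const _
    · simp [image_eq_zero_of_notMem_tsupport ht, tendsto_const_nhds]

theorem IsSmoothWeight.hasLeviMeasures_toricExt {g : ℝ → ℝ} {c : ℝ} (hg : IsSmoothWeight g c) :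
    HasLeviMeasures puncturedBidisc (toricExt g c) :=
  hasLeviMeasures_of_contDiffOn hg.contDiffOn_toricExt hg.aeLeviNonneg_toricExt

variable {χ : ℝ → ℝ}

theorem IsWeight.hasLeviMeasures_toricExt (hχ : IsWeight χ) :
    HasLeviMeasures puncturedBidisc (toricExt χ (sInf (χ '' Iio 0))) := by
  obtain ⟨g, c, hg, -, hunif⟩ := hχ.exists_approx
  exact hasLeviMeasures_of_tendstoLocallyUniformlyOn (fun n => (hg n).contDiffOn_toricExt)
    (fun n => (hg n).aeLeviNonneg_toricExt) hunif

theorem IsWeight.le_mongeAmpere_toricExt (hχ : IsWeight χ) (θ : ToricCutoff) :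
    2 * Real.pi ^ 2 * θ.mass * (2 * (∫ t, χ t * deriv (deriv θ.profile) t) - 1)
      ≤ mongeAmpere puncturedBidisc (toricExt χ (sInf (χ '' Iio 0))) θ.testFunction := by
  obtain ⟨g, c, hg, hlim, hunif⟩ := hχ.exists_approx
  have hcont (n) := (hg n).contDiffOn_toricExt.continuousOn
  have hmongeAmpere := tendsto_mongeAmpere (hunif.continuousOn (Frequently.of_forall hcont)) hcont
    hunif hχ.hasLeviMeasures_toricExt (fun n => (hg n).hasLeviMeasures_toricExt) θ.testFunction
  have hintegral := tendsto_integral_mul_of_monotoneOn θ.compactlySupportedIn_deriv_deriv_profile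
    (fun n => (hg n).contDiff.continuous.continuousOn) (fun n => (hg n).monotoneOn) hlim
  exact le_of_tendsto_of_tendsto' (((hintegral.const_mul 2).sub_const 1).const_mul _) hmongeAmpere
    fun n => θ.le_mongeAmpere_toricExt (hg n)

end LowerBound

theorem mainTheorem3_general (χ : ℕ → ℝ → ℝ)
    (hbdd : ∀ m, BddBelow (χ m '' Set.Iio 0))
    (hconv : ∀ m, ConvexOn ℝ (Set.Iio 0) (χ m))
    (hmono : ∀ m, MonotoneOn (χ m) (Set.Iio 0))
    (hlim : ∀ t < 0, Tendsto (fun m => χ m t) atTop (𝓝 t)) :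
    (∀ m, HasLeviMeasures puncturedBidisc (fun p => extendBot (χ m) (blockiFun p))) ∧
    ¬ ∀ φ : 𝓓(puncturedBidisc, ℝ),
      Tendsto (fun m => mongeAmpere puncturedBidisc
        (fun p => extendBot (χ m) (blockiFun p)) φ) atTop (𝓝 0) := by
  have hχ (m) : IsWeight (χ m) := ⟨hbdd m, hconv m, hmono m⟩
  simp only [extendBot_blockiFun]
  refine ⟨fun m => (hχ m).hasLeviMeasures_toricExt, fun hzero => ?_⟩
  obtain ⟨θ⟩ := nonempty_toricCutoff
  have hintegral := tendsto_integral_mul_of_monotoneOn θ.compactlySupportedIn_deriv_deriv_profile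
    (fun m => (hχ m).continuousOn) hmono hlim
  rw [θ.integral_id_mul_deriv_deriv_profile] at hintegral
  have hle : 2 * Real.pi ^ 2 * θ.mass * (2 * 1 - 1) ≤ 0 :=
    le_of_tendsto_of_tendsto' (((hintegral.const_mul 2).sub_const 1).const_mul _)
      (hzero θ.testFunction) fun m => (hχ m).le_mongeAmpere_toricExt θ
  have hpos : 0 < 2 * Real.pi ^ 2 * θ.mass := mul_pos (by positivity) θ.mass_pos
  linarith

theorem mainTheorem3 (χ : ℕ → ℝ → ℝ)
    (hneg : ∀ m, Set.MapsTo (χ m) (Set.Iio 0) (Set.Iio 0))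
    (hbdd : ∀ m, Bornology.IsBounded (χ m '' Set.Iio 0))
    (hconv : ∀ m, ConvexOn ℝ (Set.Iio 0) (χ m))
    (hmono : ∀ m, MonotoneOn (χ m) (Set.Iio 0))
    (hdecr : ∀ t < 0, Antitone (fun m => χ m t))
    (hlim : ∀ t < 0, Tendsto (fun m => χ m t) atTop (𝓝 t)) :
    (∀ m, HasLeviMeasures puncturedBidisc (fun p => extendBot (χ m) (blockiFun p))) ∧
    ¬ ∀ φ : 𝓓(puncturedBidisc, ℝ),
      Tendsto (fun m => mongeAmpere puncturedBidisc
        (fun p => extendBot (χ m) (blockiFun p)) φ) atTop (𝓝 0) :=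
  mainTheorem3_general χ (fun m => (hbdd m).bddBelow) hconv hmono hlim
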